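/- **Network.** Let $G_P$ be a finite directed graph without loops, in which every link $(u,v)$ has a transmission capacity $\mu_{uv}\in(0,\infty]$ and every node $u$ a computation capacity $\mu_u\in[0,\infty)$, at least one of them positive. Let $|V_P|$ be the number of nodes with positive computation capacity and $|E_P|$ the number of links with finite transmission capacity. Assume that $G_P$ is $k$-edge-connected, $k\ge 1$, i.e. it stays strongly connected after the removal of any fewer than $k$ links. **Jobs.** There are $J$ jobs. Job $j$ has a source $s^j$, a destination $t^j\ne s^j$, $L^j\ge1$ layers with computational loads $c^j_1,\dots,c^j_{L^j}\ge0$, an input data size $d^j_0>0$ and output data sizes $d^j_1,\dots,d^j_{L^j}>0$. The layered graph of job $j$ consists of copies $0,\dots,L^j$ of $G_P$, with a cross-layer edge from $u_{l-1}$ to $u_l$ for each node $u$ and $1\le l\le L^j$. An edge $e=(u_l,v_l)$ inside layer $l$ has task $q_e=d^j_l$ and capacity $\mu_e=\mu_{uv}$; the cross-layer edge $e=(u_{l-1},u_l)$ has task $q_e=c^j_l$ and capacity $\mu_e=\mu_u$. A route of job $j$ is a walk from $s^j_0$ to $t^j_{L^j}$ in its layered graph. It translates to a simple path if, after each cross-layer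 edge is contracted, the resulting walk in $G_P$ visits no node twice. **Single-job problem.** For queue lengths $Q=(Q_u,Q_{uv})$ let $C^j(Q)$ be the minimum of $$\sum_{e}\frac{q_e}{\mu_e}r_e+\sum_{e=(u_l,v_l)}\frac{Q_{uv}}{\mu_{uv}}r_e+\sum_u\frac{Q_u}{\mu_u}z_u$$ (the first sum over all the edges of the layered graph, the second over those inside the layers) over binary $r,z$ such that $z_u\ge r_{u_{l-1}u_l}$ for all $u,l$ and $r$ is a unit flow from $s^j_0$ to $t^j_{L^j}$ in the layered graph. **Greedy algorithm.** Start with $Q=0$. Repeatedly choose a remaining job $j$ with the smallest $C^j(Q)$, route it by an optimal solution $r$ of its problem, give it the next lower priority, remove it, and add each $q_er_e$ to the queue of the node or link of $G_P$ to which $e$ belongs. Ties are broken arbitrarily. **Actual system.** All jobs are released at time $0$. A job performs the transmissions and computations along its route one after the other; the one belonging to $e$ needs service time $q_e/\mu_e$ at its link or node (zero if $\mu_e=\infty$ or $q_e=0$). Under preemptive priority scheduling, every link and node always serves the job of highest priority present there. The job completion time is the time at which the last job is finished. Let $T^*$ be the infimum of the job completion time over all choices of routes and all ways of scheduling the service in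 which no link or node exceeds its capacity. **Theorem.** Consider any run of the greedy algorithm in which the solution routing each job is a route that translates to a simple path. Then the job completion time, in the actual system, of the routes and priorities found by this run under preemptive priority scheduling is at most $\alpha T^*$, where $$\alpha=\max\left\{2\alpha_{tx},\ \frac{2(L+1)(|V_P|+|E_P|)\,\alpha_{tx}}{k},\ \left(1+\frac{|E_P|}{|V_P|}\right)\alpha_{cp}\right\}\left(2-\frac1{|V_P|+|E_P|}\right),$$ $$\alpha_{tx}=\frac{h_L\cdot\max_{j,l}d^j_l\cdot\max_{(u,v)}\mu_{uv}}{h_S\cdot\min_{j,l}d^j_l\cdot\min_{(u,v)}\mu_{uv}},\qquad \alpha_{cp}=\frac{\max_{\mu_u>0}\mu_u}{\min_{\mu_u>0}\mu_u}.$$ Here $L=\max_jL^j$, $h_L$ is the maximum over $j$ of the largest hop count of a simple path from $s^j$ to $t^j$ in $G_P$, $h_S$ is the minimum over $j$ of the smallest such hop count, and the extrema of $\mu_{uv}$ are over all links. (So $\alpha_{tx}=\infty$ if some but not all links have infinite capacity, and $\alpha_{tx}$ is read as $0$ if all of them have.) -/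

import Mathlib

open scoped ENNReal NNReal
open MeasureTheory

noncomputable section

namespace DNNRouting

/-- A physical network `G_P = (V, E)`: a finite directed graph (a bidirectional connection is a
pair of opposite links) with transmission capacities in `(0, ∞]` on the links and computation
capacities in `[0, ∞)` on the nodes; at least one node can compute. -/
structure Network (V : Type*) [Fintype V] [DecidableEq V] where
  /-- the links -/
  E : Finset (V × V)
  loopless : ∀ u, (u, u) ∉ E
  /-- the transmission capacity `μ_{uv}`, possibly infinite -/
  linkRate : V → V → ℝ≥0∞
  linkRate_pos : ∀ u v, (u, v) ∈ E → 0 < linkRate u v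
  /-- the computation capacity `μ_u`, possibly zero -/
  nodeRate : V → ℝ≥0
  exists_nodeRate_pos : ∃ u, 0 < nodeRate u

/-- The inference jobs: job `j` has a source, a destination, `L j ≥ 1` layers, the computational
load `c j l` of layer `l` (only `1 ≤ l ≤ L j` matters), the input data size `d j 0` and the output
data size `d j l` of layer `l` (only `l ≤ L j` matters). -/
structure Jobs (V : Type*) where
  /-- the number of jobs -/
  J : ℕ
  src : Fin J → V
  dst : Fin J → V
  L : Fin J → ℕ
  L_pos : ∀ j, 0 < L j
  c : Fin J → ℕ → ℝ≥0
  d : Fin J → ℕ → ℝ≥0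
  d_pos : ∀ j l, l ≤ L j → 0 < d j l

variable {V : Type*} [Fintype V] [DecidableEq V]

/-! ### The physical graph -/

/-- `G_P` is `k`-edge-connected: it remains (strongly) connected after the removal of any set of
fewer than `k` links. -/
def Network.IsEdgeConnected (N : Network V) (k : ℕ) : Prop :=
  ∀ F : Finset (V × V), F ⊆ N.E → F.card < k →
    ∀ u v, Relation.ReflTransGen (fun a b => (a, b) ∈ N.E \ F) u v

/-- The hop counts of the simple paths from `s` to `t` in `G_P`. -/
def Network.pathLengths (N : Network V) (s t : V) : Set ℕ :=
  {n | ∃ p : List V, p.Nodup ∧ p.IsChain (fun a b => (a, b) ∈ N.E) ∧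
    p.head? = some s ∧ p.getLast? = some t ∧ p.length = n + 1}

/-! ### The layered graph of a job -/

/-- The nodes `u_l` of the layered graph of job `j`, written `(l, u)`, with `l ∈ {0, …, L j}`. -/
abbrev Jobs.LNode (jobs : Jobs V) (j : Fin jobs.J) : Type _ := Fin (jobs.L j + 1) × V

/-- The intra-layer edges `(u_l, v_l)` with `(u, v) ∈ E_P`. -/
def intraEdges (N : Network V) (jobs : Jobs V) (j : Fin jobs.J) :
    Finset (jobs.LNode j × jobs.LNode j) :=
  {e | e.1.1 = e.2.1 ∧ (e.1.2, e.2.2) ∈ N.E}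

/-- The cross-layer edges `(u_{l-1}, u_l)`, the set `E_C`. -/
def crossEdges (jobs : Jobs V) (j : Fin jobs.J) : Finset (jobs.LNode j × jobs.LNode j) :=
  {e | (e.2.1 : ℕ) = e.1.1 + 1 ∧ e.1.2 = e.2.2}

/-- All the edges of the layered graph. -/
def layeredEdges (N : Network V) (jobs : Jobs V) (j : Fin jobs.J) :
    Finset (jobs.LNode j × jobs.LNode j) :=
  intraEdges N jobs j ∪ crossEdges jobs j

/-- The task `q_e` of an edge: `d_l` for an edge inside layer `l`, and `c_l` for a cross-layer edge
from layer `l - 1` to layer `l`. -/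
def task (jobs : Jobs V) (j : Fin jobs.J) (e : jobs.LNode j × jobs.LNode j) : ℝ≥0 :=
  if e.1.1 = e.2.1 then jobs.d j e.1.1 else jobs.c j e.2.1

/-- The capacity `μ_e` of an edge. -/
def capacity (N : Network V) (jobs : Jobs V) (j : Fin jobs.J)
    (e : jobs.LNode j × jobs.LNode j) : ℝ≥0∞ :=
  if e.1.1 = e.2.1 then N.linkRate e.1.2 e.2.2 else (N.nodeRate e.1.2 : ℝ≥0∞)

/-- The service time `q_e / μ_e`: zero on links of infinite capacity, and infinite for a
computation of positive load at a node of zero capacity. -/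
def serviceTime (N : Network V) (jobs : Jobs V) (j : Fin jobs.J)
    (e : jobs.LNode j × jobs.LNode j) : ℝ≥0∞ :=
  (task jobs j e : ℝ≥0∞) / capacity N jobs j e

/-- The node `s_0`. -/
def Jobs.start (jobs : Jobs V) (j : Fin jobs.J) : jobs.LNode j := (0, jobs.src j)

/-- The node `t_L`. -/
def Jobs.target (jobs : Jobs V) (j : Fin jobs.J) : jobs.LNode j := (Fin.last _, jobs.dst j)

/-! ### The single-job formulation -/

/-- Queues: `node u` is `Q_u` and `link u v` is `Q_{uv}`. -/
structure Queues (V : Type*) where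
  node : V → ℝ≥0
  link : V → V → ℝ≥0

/-- The feasible points of the formulation: `r` and `z` are binary, `z_u ≥ r_e` for every
cross-layer edge `e` at `u`, and `r` carries one unit of flow from `s_0` to `t_L`.
(The values of `r` outside the edges of the layered graph are irrelevant.) -/
def IsFeasible (N : Network V) (jobs : Jobs V) (j : Fin jobs.J)
    (r : jobs.LNode j × jobs.LNode j → ℕ) (z : V → ℕ) : Prop :=
  (∀ e ∈ layeredEdges N jobs j, r e = 0 ∨ r e = 1) ∧
  (∀ u, z u = 0 ∨ z u = 1) ∧
  (∀ e ∈ crossEdges jobs j, r e ≤ z e.1.2) ∧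
  (∀ a : jobs.LNode j,
    (∑ e ∈ layeredEdges N jobs j with e.1 = a, (r e : ℤ))
      - (∑ e ∈ layeredEdges N jobs j with e.2 = a, (r e : ℤ))
    = if a = jobs.start j then 1 else if a = jobs.target j then -1 else 0)

/-- The objective: service times, plus waiting times at links, plus waiting times at nodes. -/
def objective (N : Network V) (jobs : Jobs V) (j : Fin jobs.J) (Q : Queues V)
    (r : jobs.LNode j × jobs.LNode j → ℕ) (z : V → ℕ) : ℝ≥0∞ :=
  (∑ e ∈ layeredEdges N jobs j, serviceTime N jobs j e * (r e : ℝ≥0∞))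
  + (∑ e ∈ intraEdges N jobs j,
      (Q.link e.1.2 e.2.2 : ℝ≥0∞) / N.linkRate e.1.2 e.2.2 * (r e : ℝ≥0∞))
  + ∑ u, (Q.node u : ℝ≥0∞) / (N.nodeRate u : ℝ≥0∞) * (z u : ℝ≥0∞)

/-- The optimal value `C^j(Q)`. -/
def optValue (N : Network V) (jobs : Jobs V) (j : Fin jobs.J) (Q : Queues V) : ℝ≥0∞ :=
  ⨅ (r : jobs.LNode j × jobs.LNode j → ℕ) (z : V → ℕ) (_ : IsFeasible N jobs j r z),
    objective N jobs j Q r z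

/-- `(r, z)` is an optimal solution of the formulation. -/
def IsOptimal (N : Network V) (jobs : Jobs V) (j : Fin jobs.J) (Q : Queues V)
    (r : jobs.LNode j × jobs.LNode j → ℕ) (z : V → ℕ) : Prop :=
  IsFeasible N jobs j r z ∧ objective N jobs j Q r z = optValue N jobs j Q

/-! ### The greedy algorithm -/

/-- The queues before position `p`, if the jobs are routed in the given order by the solutions `r`:
starting from empty queues, each job routed earlier adds `q_e r_e` to the queue of the physical
node or link to which the layered edge `e` belongs. -/
def queuesAt (N : Network V) (jobs : Jobs V) (order : Equiv.Perm (Fin jobs.J))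
    (r : ∀ j, jobs.LNode j × jobs.LNode j → ℕ) (p : Fin jobs.J) : Queues V where
  node u := ∑ p' ∈ Finset.univ.filter (· < p),
    ∑ e ∈ crossEdges jobs (order p') with e.1.2 = u,
      task jobs (order p') e * (r (order p') e : ℝ≥0)
  link u v := ∑ p' ∈ Finset.univ.filter (· < p),
    ∑ e ∈ intraEdges N jobs (order p') with e.1.2 = u ∧ e.2.2 = v,
      task jobs (order p') e * (r (order p') e : ℝ≥0)

/-- A run of the greedy algorithm: `order p` is the job routed at position `p` (so the priority
order is `order 0 > order 1 > ⋯`), and `r j`, `z j` is the solution with which job `j` is routed.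
At each position the job routed has the smallest `C^j(Q)` among the remaining jobs, and it is routed
by an optimal solution. All ways of breaking ties are allowed. -/
structure GreedyRun (N : Network V) (jobs : Jobs V) where
  order : Equiv.Perm (Fin jobs.J)
  r : ∀ j, jobs.LNode j × jobs.LNode j → ℕ
  z : Fin jobs.J → V → ℕ
  argmin : ∀ p p', p ≤ p' →
    optValue N jobs (order p) (queuesAt N jobs order r p)
      ≤ optValue N jobs (order p') (queuesAt N jobs order r p)
  optimal : ∀ p,
    IsOptimal N jobs (order p) (queuesAt N jobs order r p) (r (order p)) (z (order p))

/-! ### Routes -/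

/-- A route of job `j`: a walk from `s_0` to `t_L` in the layered graph. -/
structure Route (N : Network V) (jobs : Jobs V) (j : Fin jobs.J) where
  nodes : List (jobs.LNode j)
  chain : nodes.IsChain (fun a b => (a, b) ∈ layeredEdges N jobs j)
  head_eq : nodes.head? = some (jobs.start j)
  last_eq : nodes.getLast? = some (jobs.target j)

/-- The edges of a route, in the order in which they are traversed. -/
def Route.steps {N : Network V} {jobs : Jobs V} {j : Fin jobs.J} (ρ : Route N jobs j) :
    List (jobs.LNode j × jobs.LNode j) :=
  ρ.nodes.zip ρ.nodes.tail

/-- The route translates to a simple path in `G_P`: the walk of physical nodes (a cross-layer edge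
stays at its node, so equal consecutive nodes are merged) visits no node twice. -/
def Route.IsSimple {N : Network V} {jobs : Jobs V} {j : Fin jobs.J} (ρ : Route N jobs j) : Prop :=
  ((ρ.nodes.map Prod.snd).destutter (· ≠ ·)).Nodup

/-- The binary vector `r` is the indicator of the edges of the route. -/
def Route.IsGivenBy {N : Network V} {jobs : Jobs V} {j : Fin jobs.J} (ρ : Route N jobs j)
    (r : jobs.LNode j × jobs.LNode j → ℕ) : Prop :=
  ∀ e ∈ layeredEdges N jobs j, r e = 1 ↔ e ∈ ρ.steps

/-! ### The actual system -/

/-- The components of the system, each with its own queue: nodes and links. -/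
abbrev Component (V : Type*) : Type _ := V ⊕ (V × V)

/-- The operations of a job along its route, one after the other: the component that has to serve
the job, and the service time required there. -/
def Route.ops {N : Network V} {jobs : Jobs V} {j : Fin jobs.J} (ρ : Route N jobs j) :
    List (Component V × ℝ≥0∞) :=
  ρ.steps.map fun e =>
    (if e.1.1 = e.2.1 then Sum.inr (e.1.2, e.2.2) else Sum.inl e.1.2, serviceTime N jobs j e)

/-- The time interval `[t, x]`, where `t, x ∈ [0, ∞]`. -/
def window (t x : ℝ≥0∞) : Set ℝ :=
  {τ | 0 ≤ τ ∧ t ≤ ENNReal.ofReal τ ∧ ENNReal.ofReal τ ≤ x}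

/-- An operation that requires service time `w` arrives at time `t` at a component that is occupied
by jobs of higher priority during `B`. It is served whenever the component is not so occupied; this
is the time at which it is finished. -/
def finishTime (B : Set ℝ) (t w : ℝ≥0∞) : ℝ≥0∞ :=
  sInf {x | t ≤ x ∧ w ≤ volume (window t x \ B)}

/-- Executes the operations of one job, one after the other, from time `t` on, where
`B m` is the set of times at which component `m` is occupied by jobs of higher priority. Returns the
time at which the job is completed, and the updated occupied times: from the arrival of an operation
until its end, its component serves this job or one of higher priority. -/
def execJob : List (Component V × ℝ≥0∞) → ℝ≥0∞ → (Component V → Set ℝ) →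
    ℝ≥0∞ × (Component V → Set ℝ)
  | [], t, B => (t, B)
  | o :: os, t, B =>
      execJob os (finishTime (B o.1) t o.2)
        (Function.update B o.1 (B o.1 ∪ window t (finishTime (B o.1) t o.2)))

/-- Preemptive priority scheduling of jobs that are listed in decreasing priority and are all
released at time `0`: a job is not affected by jobs of lower priority. Returns the maximal
completion time. -/
def execAll : List (List (Component V × ℝ≥0∞)) → (Component V → Set ℝ) → ℝ≥0∞
  | [], _ => 0
  | o :: os, B => max (execJob o 0 B).1 (execAll os (execJob o 0 B).2)

/-- The job completion time `C_max` in the actual system with preemptive priority scheduling, for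
given routes and priorities. -/
def completionTime {N : Network V} {jobs : Jobs V} (order : Equiv.Perm (Fin jobs.J))
    (ρ : ∀ j, Route N jobs j) : ℝ≥0∞ :=
  execAll (List.ofFn fun p => (ρ (order p)).ops) fun _ => ∅

/-- An arbitrary way to route and execute the jobs in the actual system: routes, the time
`time j i` at which the first `i` operations of job `j` are done, and the fraction `service j i τ`
of its component's capacity that the `i`-th operation of job `j` gets at time `τ`. Each
operation gets its service after the previous operations of its job are done, and the capacity of a
component is never exceeded. In particular any priorities, and any scheduling with or without
preemption, are covered. -/
structure Schedule (N : Network V) (jobs : Jobs V) where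
  route : ∀ j, Route N jobs j
  time : Fin jobs.J → ℕ → ℝ≥0∞
  mono : ∀ j, Monotone (time j)
  service : Fin jobs.J → ℕ → ℝ → ℝ≥0∞
  measurable_service : ∀ j i, Measurable (service j i)
  served : ∀ j (i : Fin (route j).ops.length),
    ((route j).ops.get i).2 ≤ ∫⁻ τ in window (time j i) (time j (i + 1)), service j i τ
  capacity_le : ∀ (m : Component V) (τ : ℝ),
    ∑ j, ∑ i : Fin (route j).ops.length with ((route j).ops.get i).1 = m, service j i τ ≤ 1

/-- The job completion time of a schedule. -/
def Schedule.makespan {N : Network V} {jobs : Jobs V} (S : Schedule N jobs) : ℝ≥0∞ :=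
  ⨆ j, S.time j (S.route j).ops.length

/-- `T^*`, the minimum possible job completion time in the actual system. -/
def optTime (N : Network V) (jobs : Jobs V) : ℝ≥0∞ :=
  ⨅ S : Schedule N jobs, S.makespan

/-! ### The approximation ratio -/

/-- `|V_P|`, the number of nodes with positive computation capacity. -/
def numNodes (N : Network V) : ℕ := (Finset.univ.filter fun u => 0 < N.nodeRate u).card

open Classical in
/-- `|E_P|`, the number of links with finite transmission capacity. -/
def numLinks (N : Network V) : ℕ := (N.E.filter fun e => N.linkRate e.1 e.2 ≠ ∞).card

/-- `h_L`, the largest over the jobs of the longest path length between source and destination. -/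
def hLong (N : Network V) (jobs : Jobs V) : ℕ :=
  ⨆ j, sSup (N.pathLengths (jobs.src j) (jobs.dst j))

/-- `h_S`, the smallest over the jobs of the shortest path length between source and destination. -/
def hShort (N : Network V) (jobs : Jobs V) : ℕ :=
  ⨅ j, sInf (N.pathLengths (jobs.src j) (jobs.dst j))

/-- `L`, the largest number of layers. -/
def maxLayers (jobs : Jobs V) : ℕ := Finset.univ.sup jobs.L

/-- `α_tx`. If some but not all links have infinite capacity this is `∞`. If all links have infinite
capacity it is `∞ / ∞ = 0`, in accordance with the transmission times being zero. -/
def alphaTx (N : Network V) (jobs : Jobs V) : ℝ≥0∞ :=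
  ((hLong N jobs : ℝ≥0∞) * (⨆ (j) (l) (_ : l ≤ jobs.L j), (jobs.d j l : ℝ≥0∞))
      * (⨆ e ∈ N.E, N.linkRate e.1 e.2))
    / ((hShort N jobs : ℝ≥0∞) * (⨅ (j) (l) (_ : l ≤ jobs.L j), (jobs.d j l : ℝ≥0∞))
      * (⨅ e ∈ N.E, N.linkRate e.1 e.2))

/-- `α_cp`, over the nodes with positive computation capacity. -/
def alphaCp (N : Network V) : ℝ≥0∞ :=
  (⨆ (u) (_ : 0 < N.nodeRate u), (N.nodeRate u : ℝ≥0∞))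
    / (⨅ (u) (_ : 0 < N.nodeRate u), (N.nodeRate u : ℝ≥0∞))

/-- The approximation ratio `α`. -/
def alpha (N : Network V) (jobs : Jobs V) (k : ℕ) : ℝ≥0∞ :=
  max (2 * alphaTx N jobs)
    (max (2 * ((maxLayers jobs : ℝ≥0∞) + 1) * ((numNodes N : ℝ≥0∞) + numLinks N)
        * alphaTx N jobs / k)
      ((1 + (numLinks N : ℝ≥0∞) / numNodes N) * alphaCp N))
  * (2 - 1 / ((numNodes N : ℝ≥0∞) + numLinks N))

end DNNRouting

end

/-!
Let `m = |V_P| + |E_P|` be the number of components that can delay a job.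

*The greedy run.* Under preemptive priority scheduling, a job is delayed at a component only by
jobs of higher priority, and its stays at the components it visits do not overlap in time. It is
therefore completed within its own service times plus one full queue, left by the jobs of higher
priority, at each component on its route (`execAll_le`). This is what the objective of the
single-job problem charges, so job `j` is completed by time `C^j(Q)` for the queues `Q` with which
it was routed (`GreedyRun.completionTime_le`).

*An upper bound on `C^j(Q)`.* Some node `u` of positive capacity has a queue of at most the
average delay. The job can go from its source to `u`, perform all its computations there, and go
on to its destination. In a `k`-edge-connected network, a shortest path with respect to the delays
of the links costs at most `1 / k` of the total delay of all links: every level set of the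
distance is a cut, hence is left by at least `k` links (`mul_potential_le`, `exists_path_mul_le`).
Such a path has at most `|V|` links, which gives `optValue_le_average`. A path to `u` may be
longer than `h_L`, but if transmissions take time at all then `k |V| ≤ |E_P|`, since every node
has `k` outgoing links, and the second term of the ratio pays for the excess.

*Lower bounds on `T^*`.* In any schedule, the total service time of a job, and the total service
time of all jobs divided by `m`, are at most the completion time (`Schedule.total_le`,
`Schedule.sum_total_le`). Each route has at least `h_S` transmissions and carries out all the
computations, so the transmission times of the greedy route, which has at most `h_L` transmissions
since it is simple, exceed those of any other route by at most the factor `α_tx`, and the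
computation times on nodes of positive capacity by at most `α_cp`.

*Combination.* As in Graham's analysis of list scheduling, the length of a job plus the average
over the `m` components of the work ahead of it is at most `(2 - 1 / m) T^*` (`add_sum_div_le`).
If some but not all links have infinite capacity, then `α = ∞`, and only `T^* = 0` needs an
argument: then all loads are zero, and there are routes on which neither service nor queues take
time (`GreedyRun.completionTime_eq_zero`).
-/

set_option linter.unusedSectionVars false

noncomputable section

namespace DNNRouting

variable {V : Type*} [Fintype V] [DecidableEq V]

/-! ### Walks as lists of vertices -/

section Walks

variable {α β : Type*} {R : α → α → Prop}

/-- The pairs of consecutive entries of a list: the edges of the walk that it lists. -/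
def pairs (l : List α) : List (α × α) := l.zip l.tail

@[simp] lemma pairs_nil : pairs ([] : List α) = [] := rfl

@[simp] lemma pairs_singleton (a : α) : pairs [a] = [] := rfl

@[simp] lemma pairs_cons_cons (a b : α) (l : List α) :
    pairs (a :: b :: l) = (a, b) :: pairs (b :: l) := rfl

lemma pairs_append_cons (l₁ : List α) (a : α) (l₂ : List α) :
    pairs (l₁ ++ a :: l₂) = pairs (l₁ ++ [a]) ++ pairs (a :: l₂) := by
  induction l₁ with
  | nil => simp
  | cons b l ih => cases l <;> simp_all

lemma pairs_map (f : α → β) (l : List α) : pairs (l.map f) = (pairs l).map (Prod.map f f) := by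
  simp only [pairs, ← List.map_tail, List.zip_map, Prod.map_def]

lemma map_fst_pairs (l : List α) : (pairs l).map Prod.fst = l.dropLast := by
  induction l with
  | nil => rfl
  | cons a l ih => cases l <;> simp_all

lemma map_snd_pairs (l : List α) : (pairs l).map Prod.snd = l.tail := by
  induction l with
  | nil => rfl
  | cons a l ih => cases l <;> simp_all

lemma length_pairs (l : List α) : (pairs l).length = l.length - 1 := by
  simp [pairs]

lemma nodup_pairs {l : List α} (h : l.Nodup) : (pairs l).Nodup := by
  apply List.Nodup.of_map Prod.fst
  rw [map_fst_pairs]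
  exact h.sublist (List.dropLast_sublist l)

lemma isChain_iff_pairs {l : List α} : l.IsChain R ↔ ∀ e ∈ pairs l, R e.1 e.2 := by
  induction l with
  | nil => simp
  | cons a l ih => cases l <;> simp_all

/-- The list `l` is a walk from `a` to `b` along the relation `R`. -/
structure IsWalk (R : α → α → Prop) (a b : α) (l : List α) : Prop where
  chain : l.IsChain R
  head_eq : l.head? = some a
  last_eq : l.getLast? = some b

lemma IsWalk.ne_nil {a b : α} {l : List α} (h : IsWalk R a b l) : l ≠ [] := by
  rintro rfl
  simpa using h.head_eq

lemma IsWalk.length_eq {a b : α} {l : List α} (h : IsWalk R a b l) :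
    l.length = (pairs l).length + 1 := by
  have := List.length_pos_iff.2 h.ne_nil
  rw [length_pairs]
  omega

lemma isWalk_singleton (a : α) : IsWalk R a a [a] := ⟨by simp, rfl, rfl⟩

lemma IsWalk.cons {a b c : α} {l : List α} (h : IsWalk R b c l) (hab : R a b) :
    IsWalk R a c (a :: l) := by
  obtain ⟨h1, h2, h3⟩ := h
  cases l with
  | nil => simp at h2
  | cons x l =>
    obtain rfl : x = b := by simpa using h2
    exact ⟨by simp [hab, h1], rfl, by simpa using h3⟩

lemma IsWalk.tail {a b c : α} {l : List α} (h : IsWalk R a c (a :: b :: l)) :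
    R a b ∧ IsWalk R b c (b :: l) := by
  obtain ⟨h1, h2, h3⟩ := h
  rw [List.isChain_cons_cons] at h1
  exact ⟨h1.1, h1.2, rfl, by simpa using h3⟩

/-- Cutting out the closed parts of a walk makes it simple; no edges are added. -/
lemma IsWalk.exists_nodup {a b : α} {l : List α} (h : IsWalk R a b l) :
    ∃ l', IsWalk R a b l' ∧ l'.Nodup ∧ (pairs l').Sublist (pairs l) := by
  induction l generalizing a with
  | nil => exact absurd rfl h.ne_nil
  | cons x l ih =>
    obtain rfl : x = a := by simpa using h.head_eq
    cases l with
    | nil => exact ⟨[x], h, by simp, List.Sublist.refl _⟩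
    | cons y l =>
      obtain ⟨hxy, hw⟩ := h.tail
      obtain ⟨p, hp, hnd, hsub⟩ := ih hw
      by_cases hx : x ∈ p
      · obtain ⟨s, t, rfl⟩ := List.append_of_mem hx
        refine ⟨x :: t, ⟨?_, rfl, ?_⟩, ?_, ?_⟩
        · exact (List.isChain_split.1 hp.chain).2
        · simpa using hp.last_eq
        · exact hnd.sublist (List.sublist_append_right _ _)
        · rw [pairs_append_cons] at hsub
          rw [pairs_cons_cons]
          exact ((List.sublist_append_right _ _).trans hsub).trans (List.sublist_cons_self _ _)
      · refine ⟨x :: p, hp.cons hxy, List.nodup_cons.2 ⟨hx, hnd⟩, ?_⟩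
        cases p with
        | nil => exact absurd rfl hp.ne_nil
        | cons z p =>
          obtain rfl : z = y := by simpa using hp.head_eq
          simpa using hsub

lemma exists_isWalk {a b : α} (h : Relation.ReflTransGen R a b) : ∃ l, IsWalk R a b l := by
  induction h using Relation.ReflTransGen.head_induction_on with
  | refl => exact ⟨_, isWalk_singleton b⟩
  | head hab _ ih =>
    obtain ⟨l, hl⟩ := ih
    exact ⟨_, hl.cons hab⟩

lemma IsWalk.append {a b c : α} {l₁ l₂ : List α} (h₁ : IsWalk R a b (l₁ ++ [b]))
    (h₂ : IsWalk R b c (b :: l₂)) : IsWalk R a c (l₁ ++ b :: l₂) := by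
  refine ⟨List.isChain_split.2 ⟨h₁.chain, h₂.chain⟩, ?_, ?_⟩
  · have := h₁.head_eq
    cases l₁ <;> simpa using this
  · simpa using h₂.last_eq

lemma IsWalk.eq_append_singleton {a b : α} {l : List α} (h : IsWalk R a b l) :
    ∃ l', l = l' ++ [b] :=
  List.getLast?_eq_some_iff.1 h.last_eq

lemma IsWalk.eq_cons {a b : α} {l : List α} (h : IsWalk R a b l) : ∃ l', l = a :: l' :=
  List.head?_eq_some_iff.1 h.head_eq

lemma IsWalk.map {S : β → β → Prop} {a b : α} {l : List α} (h : IsWalk R a b l) (f : α → β)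
    (hf : ∀ x y, R x y → S (f x) (f y)) : IsWalk S (f a) (f b) (l.map f) :=
  ⟨List.isChain_map_of_isChain f hf h.chain, by simp [h.head_eq], by simp [h.last_eq]⟩

end Walks

/-! ### Walks in the layered graph -/

section Layered

variable {N : Network V} {jobs : Jobs V} {j : Fin jobs.J}

lemma mem_intraEdges {e : jobs.LNode j × jobs.LNode j} :
    e ∈ intraEdges N jobs j ↔ e.1.1 = e.2.1 ∧ (e.1.2, e.2.2) ∈ N.E := by
  simp [intraEdges]

lemma mem_crossEdges {e : jobs.LNode j × jobs.LNode j} :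
    e ∈ crossEdges jobs j ↔ (e.2.1 : ℕ) = e.1.1 + 1 ∧ e.1.2 = e.2.2 := by
  simp [crossEdges]

lemma mem_layeredEdges {e : jobs.LNode j × jobs.LNode j} :
    e ∈ layeredEdges N jobs j ↔ e ∈ intraEdges N jobs j ∨ e ∈ crossEdges jobs j := by
  simp [layeredEdges]

lemma layer_ne_of_mem_crossEdges {e : jobs.LNode j × jobs.LNode j}
    (he : e ∈ crossEdges jobs j) : e.1.1 ≠ e.2.1 := by
  intro h
  have := (mem_crossEdges.1 he).1
  rw [h] at this
  omega

lemma mem_intraEdges_iff {e : jobs.LNode j × jobs.LNode j} (he : e ∈ layeredEdges N jobs j) :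
    e ∈ intraEdges N jobs j ↔ e.1.1 = e.2.1 :=
  ⟨fun h => (mem_intraEdges.1 h).1, fun h => (mem_layeredEdges.1 he).resolve_right
    fun h' => layer_ne_of_mem_crossEdges h' h⟩

lemma mem_crossEdges_iff {e : jobs.LNode j × jobs.LNode j} (he : e ∈ layeredEdges N jobs j) :
    e ∈ crossEdges jobs j ↔ e.1.1 ≠ e.2.1 :=
  ⟨layer_ne_of_mem_crossEdges, fun h => (mem_layeredEdges.1 he).resolve_left
    fun h' => h (mem_intraEdges.1 h').1⟩

/-- The adjacency of the layered graph. -/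
abbrev LAdj (N : Network V) (jobs : Jobs V) (j : Fin jobs.J) (a b : jobs.LNode j) : Prop :=
  (a, b) ∈ layeredEdges N jobs j

lemma Route.isWalk (ρ : Route N jobs j) :
    IsWalk (LAdj N jobs j) (jobs.start j) (jobs.target j) ρ.nodes :=
  ⟨ρ.chain, ρ.head_eq, ρ.last_eq⟩

lemma Route.mem_layeredEdges (ρ : Route N jobs j) {e : jobs.LNode j × jobs.LNode j}
    (he : e ∈ ρ.steps) : e ∈ layeredEdges N jobs j :=
  isChain_iff_pairs.1 ρ.chain e he

/-- A walk in the layered graph crosses into each of the layers between its ends exactly once. -/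
lemma sum_cross_of_isWalk {a b : jobs.LNode j} {l : List (jobs.LNode j)}
    (h : IsWalk (LAdj N jobs j) a b l) (f : ℕ → ℝ≥0∞) :
    (a.1 : ℕ) ≤ b.1 ∧ ((pairs l).map fun e => if e.1.1 = e.2.1 then 0 else f e.2.1).sum
      = ∑ i ∈ Finset.Ico (a.1 : ℕ) b.1, f (i + 1) := by
  induction l generalizing a with
  | nil => exact absurd rfl h.ne_nil
  | cons x l ih =>
    obtain rfl : x = a := by simpa using h.head_eq
    cases l with
    | nil =>
      obtain rfl : x = b := by simpa using h.last_eq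
      simp
    | cons y l =>
      obtain ⟨hxy, hw⟩ := h.tail
      obtain ⟨h1, h2⟩ := ih hw
      rw [pairs_cons_cons, List.map_cons, List.sum_cons, h2]
      rcases DNNRouting.mem_layeredEdges.1 hxy with he | he
      · have := (mem_intraEdges.1 he).1
        simp only at this
        simp [this, h1]
      · have hne := layer_ne_of_mem_crossEdges he
        have := (mem_crossEdges.1 he).1
        simp only at this hne
        refine ⟨by omega, ?_⟩
        rw [if_neg hne, this, Finset.sum_eq_sum_Ico_succ_bot (show (x.1 : ℕ) < b.1 by omega)]

lemma layer_le_of_isWalk {a b : jobs.LNode j} {l : List (jobs.LNode j)}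
    (h : IsWalk (LAdj N jobs j) a b l) {z : jobs.LNode j} (hz : z ∈ l) : (a.1 : ℕ) ≤ z.1 := by
  obtain ⟨s, t, rfl⟩ := List.append_of_mem hz
  refine (sum_cross_of_isWalk (N := N) (b := z) (l := s ++ [z]) ⟨?_, ?_, by simp⟩ 0).1
  · exact (List.isChain_split.1 h.chain).1
  · have := h.head_eq
    cases s <;> simpa using this

lemma head?_destutter' {α : Type*} [DecidableEq α] (a : α) (l : List α) :
    (l.destutter' (· ≠ ·) a).head? = some a := by
  induction l with
  | nil => rfl
  | cons b l ih => by_cases h : a = b <;> simp_all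

lemma getLast?_destutter' {α : Type*} [DecidableEq α] (a : α) (l : List α) :
    (l.destutter' (· ≠ ·) a).getLast? = (a :: l).getLast? := by
  induction l generalizing a with
  | nil => rfl
  | cons b l ih =>
    by_cases h : a = b
    · subst h
      rw [List.destutter'_cons_neg _ (by simp), ih]
      simp
    · rw [List.destutter'_cons_pos _ h, List.getLast?_cons, ih, List.getLast?_cons_cons,
        List.getLast?_cons]
      rfl

lemma mem_destutter'_of_mem {α : Type*} [DecidableEq α] {a z : α} {l : List α}
    (hz : z ∈ a :: l) : z ∈ l.destutter' (· ≠ ·) a := by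
  induction l generalizing a with
  | nil => exact hz
  | cons b l ih =>
    by_cases h : a = b
    · subst h
      rw [List.destutter'_cons_neg _ (by simp)]
      exact ih (by simpa using hz)
    · rw [List.destutter'_cons_pos _ h, List.mem_cons]
      exact (List.mem_cons.1 hz).imp id ih

/-- The edges inside the layers, projected to the links of the network, are the links of the walk in
which cross-layer edges are contracted. -/
lemma pairs_destutter {a b : jobs.LNode j} {l : List (jobs.LNode j)}
    (h : IsWalk (LAdj N jobs j) a b l) :
    pairs ((l.map Prod.snd).destutter (· ≠ ·))
      = ((pairs l).filter fun e => e.1.1 = e.2.1).map fun e => (e.1.2, e.2.2) := by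
  induction l generalizing a with
  | nil => rfl
  | cons x l ih =>
    obtain rfl : x = a := by simpa using h.head_eq
    cases l with
    | nil => rfl
    | cons y l =>
      obtain ⟨hxy, hw⟩ := h.tail
      have ih := ih hw
      rw [List.map_cons, List.destutter_cons'] at ih
      rw [List.map_cons, List.destutter_cons', List.map_cons]
      rcases DNNRouting.mem_layeredEdges.1 hxy with he | he
      · obtain ⟨h1, h2⟩ := mem_intraEdges.1 he
        simp only at h1 h2
        have hne : x.2 ≠ y.2 := fun h' => N.loopless y.2 (by rwa [h'] at h2)
        rw [List.destutter'_cons_pos _ hne, pairs_cons_cons, List.filter_cons_of_pos (by simp [h1]),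
          List.map_cons, ← ih]
        obtain ⟨t, ht⟩ : ∃ t, List.destutter' (· ≠ ·) y.2 (l.map Prod.snd) = y.2 :: t := by
          exact List.head?_eq_some_iff.1 (head?_destutter' _ _)
        rw [ht, pairs_cons_cons]
      · have hne := layer_ne_of_mem_crossEdges he
        have h2 := (mem_crossEdges.1 he).2
        simp only at h2 hne
        rw [List.destutter'_cons_neg _ (by simp [h2]), pairs_cons_cons,
          List.filter_cons_of_neg (by simp [hne]), ← ih, h2]

/-- The adjacency of the physical graph. -/
abbrev PAdj (N : Network V) (u v : V) : Prop := (u, v) ∈ N.E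

lemma isWalk_destutter {a b : jobs.LNode j} {l : List (jobs.LNode j)}
    (h : IsWalk (LAdj N jobs j) a b l) :
    IsWalk (PAdj N) a.2 b.2 ((l.map Prod.snd).destutter (· ≠ ·)) := by
  refine ⟨?_, ?_, ?_⟩
  · rw [isChain_iff_pairs, pairs_destutter h]
    intro e he
    simp only [List.mem_map, List.mem_filter, decide_eq_true_eq] at he
    obtain ⟨e, ⟨he, h1⟩, rfl⟩ := he
    exact (mem_intraEdges.1 ((mem_intraEdges_iff (isChain_iff_pairs.1 h.chain e he)).2 h1)).2
  · obtain ⟨t, rfl⟩ := h.eq_cons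
    exact head?_destutter' _ _
  · obtain ⟨t, rfl⟩ := h.eq_cons
    have := getLast?_destutter' a.2 (t.map Prod.snd)
    rw [List.map_cons, List.destutter_cons', this, ← List.map_cons, List.getLast?_map, h.last_eq]
    rfl

/-- A walk of the layered graph that translates to a simple path repeats no node: it cannot return
to a layer that it has left, and inside a layer it moves along the simple path. -/
lemma nodup_of_destutter {a b : jobs.LNode j} {l : List (jobs.LNode j)}
    (h : IsWalk (LAdj N jobs j) a b l) (hnd : ((l.map Prod.snd).destutter (· ≠ ·)).Nodup) :
    l.Nodup := by
  induction l generalizing a with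
  | nil => exact List.nodup_nil
  | cons x l ih =>
    obtain rfl : x = a := by simpa using h.head_eq
    cases l with
    | nil => simp
    | cons y l =>
      obtain ⟨hxy, hw⟩ := h.tail
      have ih := ih hw
      rw [List.map_cons, List.destutter_cons'] at ih
      rw [List.map_cons, List.destutter_cons', List.map_cons] at hnd
      rcases DNNRouting.mem_layeredEdges.1 hxy with he | he
      · obtain ⟨h1, h2⟩ := mem_intraEdges.1 he
        simp only at h1 h2
        have hne : x.2 ≠ y.2 := fun h' => N.loopless y.2 (by rwa [h'] at h2)
        rw [List.destutter'_cons_pos _ hne, List.nodup_cons] at hnd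
        refine List.nodup_cons.2 ⟨fun hx => hnd.1 (mem_destutter'_of_mem ?_), ih hnd.2⟩
        exact List.mem_map_of_mem (f := Prod.snd) hx
      · have h2 := (mem_crossEdges.1 he).2
        simp only at h2
        rw [List.destutter'_cons_neg _ (by simp [h2]), h2] at hnd
        refine List.nodup_cons.2 ⟨fun hx => ?_, ih hnd⟩
        have h3 := layer_le_of_isWalk hw hx
        have h4 := (mem_crossEdges.1 he).1
        simp only at h4
        omega

lemma Route.nodup_nodes {ρ : Route N jobs j} (hρ : ρ.IsSimple) : ρ.nodes.Nodup :=
  nodup_of_destutter ρ.isWalk hρ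

lemma Route.nodup_steps {ρ : Route N jobs j} (hρ : ρ.IsSimple) : ρ.steps.Nodup :=
  nodup_pairs (ρ.nodup_nodes hρ)

/-- The number of links on a route. -/
def Route.hops (ρ : Route N jobs j) : ℕ := (ρ.steps.filter fun e => e.1.1 = e.2.1).length

lemma pathLengths_eq (N : Network V) (s t : V) :
    N.pathLengths s t = {n | ∃ p, IsWalk (PAdj N) s t p ∧ p.Nodup ∧ p.length = n + 1} := by
  ext n
  exact ⟨fun ⟨p, h1, h2, h3, h4, h5⟩ => ⟨p, ⟨h2, h3, h4⟩, h1, h5⟩,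
    fun ⟨p, ⟨h2, h3, h4⟩, h1, h5⟩ => ⟨p, h1, h2, h3, h4, h5⟩⟩

lemma length_destutter_nodes (ρ : Route N jobs j) :
    ((ρ.nodes.map Prod.snd).destutter (· ≠ ·)).length = ρ.hops + 1 := by
  rw [(isWalk_destutter ρ.isWalk).length_eq, pairs_destutter ρ.isWalk, List.length_map]
  rfl

lemma le_card_of_mem_pathLengths {s t : V} {n : ℕ} (h : n ∈ N.pathLengths s t) :
    n + 1 ≤ Fintype.card V := by
  rw [pathLengths_eq] at h
  obtain ⟨p, -, hnd, hp⟩ := h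
  exact hp ▸ hnd.length_le_card

lemma Route.hops_le_hLong {ρ : Route N jobs j} (hρ : ρ.IsSimple) : ρ.hops ≤ hLong N jobs := by
  have hmem : ρ.hops ∈ N.pathLengths (jobs.src j) (jobs.dst j) := by
    rw [pathLengths_eq]
    exact ⟨_, isWalk_destutter ρ.isWalk, hρ, length_destutter_nodes ρ⟩
  refine (le_csSup ⟨Fintype.card V, fun n hn => ?_⟩ hmem).trans
    (le_ciSup (f := fun j => sSup (N.pathLengths (jobs.src j) (jobs.dst j)))
      (Set.finite_range _).bddAbove j)
  exact (Nat.le_succ n).trans (le_card_of_mem_pathLengths hn)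

lemma hShort_le_of_isWalk {l : List V} (h : IsWalk (PAdj N) (jobs.src j) (jobs.dst j) l) :
    hShort N jobs + 1 ≤ l.length := by
  obtain ⟨p, hp, hnd, hsub⟩ := h.exists_nodup
  have h1 : (pairs p).length ∈ N.pathLengths (jobs.src j) (jobs.dst j) := by
    rw [pathLengths_eq]
    exact ⟨p, hp, hnd, hp.length_eq⟩
  have h2 : hShort N jobs ≤ (pairs p).length :=
    (ciInf_le (OrderBot.bddBelow _) j).trans (Nat.sInf_le h1)
  have := hsub.length_le
  rw [h.length_eq]
  omega

lemma Route.hShort_le_hops (ρ : Route N jobs j) : hShort N jobs ≤ ρ.hops := by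
  have := hShort_le_of_isWalk (isWalk_destutter ρ.isWalk)
  rw [length_destutter_nodes] at this
  omega

end Layered

/-! ### Preemptive priority scheduling -/

section Execution

lemma window_eq_Icc {t x : ℝ≥0∞} (ht : t ≠ ∞) (hx : x ≠ ∞) :
    window t x = Set.Icc t.toReal x.toReal := by
  ext τ
  simp only [window, Set.mem_ofPred_eq, Set.mem_Icc]
  constructor
  · rintro ⟨h0, h1, h2⟩
    exact ⟨ENNReal.toReal_le_of_le_ofReal h0 h1, (ENNReal.ofReal_le_iff_le_toReal hx).1 h2⟩
  · rintro ⟨h1, h2⟩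
    exact ⟨ENNReal.toReal_nonneg.trans h1, (ENNReal.le_ofReal_iff_toReal_le ht
      (ENNReal.toReal_nonneg.trans h1)).2 h1, (ENNReal.ofReal_le_iff_le_toReal hx).2 h2⟩

lemma window_top_eq_Ici {t : ℝ≥0∞} (ht : t ≠ ∞) : window t ∞ = Set.Ici t.toReal := by
  ext τ
  simp only [window, Set.mem_ofPred_eq, Set.mem_Ici, le_top, and_true]
  constructor
  · rintro ⟨h0, h1⟩
    exact ENNReal.toReal_le_of_le_ofReal h0 h1
  · intro h1
    exact ⟨ENNReal.toReal_nonneg.trans h1, (ENNReal.le_ofReal_iff_toReal_le ht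
      (ENNReal.toReal_nonneg.trans h1)).2 h1⟩

lemma window_top_left (x : ℝ≥0∞) : window ∞ x = ∅ := by
  ext τ
  simp [window]

lemma volume_window (t x : ℝ≥0∞) : volume (window t x) = x - t := by
  by_cases ht : t = ∞
  · simp [ht, window_top_left]
  by_cases hx : x = ∞
  · subst hx
    rw [window_top_eq_Ici ht, Real.volume_Ici, ENNReal.top_sub ht]
  · rw [window_eq_Icc ht hx, Real.volume_Icc, ENNReal.ofReal_sub _ ENNReal.toReal_nonneg,
      ENNReal.ofReal_toReal ht, ENNReal.ofReal_toReal hx]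

lemma measurableSet_window (t x : ℝ≥0∞) : MeasurableSet (window t x) := by
  by_cases ht : t = ∞
  · simp [ht, window_top_left]
  by_cases hx : x = ∞
  · subst hx
    rw [window_top_eq_Ici ht]
    exact measurableSet_Ici
  · rw [window_eq_Icc ht hx]
    exact measurableSet_Icc

lemma window_mono {t t' x x' : ℝ≥0∞} (ht : t' ≤ t) (hx : x ≤ x') : window t x ⊆ window t' x' :=
  fun _ h => ⟨h.1, ht.trans h.2.1, h.2.2.trans hx⟩

/-- Two consecutive windows have at most one point in common. -/
lemma volume_window_inter (t x y : ℝ≥0∞) : volume (window t x ∩ window x y) = 0 := by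
  refine measure_mono_null (t := {x.toReal}) ?_ (by simp)
  rintro τ ⟨⟨h0, -, h1⟩, -, h2, -⟩
  rw [Set.mem_singleton_iff, ← le_antisymm h1 h2, ENNReal.toReal_ofReal h0]

lemma le_finishTime (B : Set ℝ) (t w : ℝ≥0∞) : t ≤ finishTime B t w :=
  le_sInf fun _ hx => hx.1

/-- Between its arrival and its end, an operation is served for no longer than it requires. -/
lemma volume_window_finishTime_sdiff_le (B : Set ℝ) (t w : ℝ≥0∞) :
    volume (window t (finishTime B t w) \ B) ≤ w := by
  set x := finishTime B t w with hx
  rcases (le_finishTime B t w).eq_or_lt with h | h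
  · refine (measure_mono Set.sdiff_subset).trans ?_
    rw [volume_window, hx, ← h, tsub_self]
    exact zero_le
  · obtain ⟨y, hy, hylt, hyl⟩ := exists_seq_strictMono_tendsto' h
    have hlt : ∀ n, volume (window t (y n) \ B) ≤ w := fun n => by
      by_contra! hc
      exact (hylt n).2.not_ge (hx ▸ sInf_le ⟨(hylt n).1.le, hc.le⟩)
    have hsub : window t x \ B ⊆ (⋃ n, window t (y n) \ B) ∪ {x.toReal} := by
      rintro τ ⟨⟨h0, h1, h2⟩, hB⟩
      rcases h2.eq_or_lt with h2 | h2
      · right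
        rw [Set.mem_singleton_iff, ← h2, ENNReal.toReal_ofReal h0]
      · left
        obtain ⟨n, hn⟩ := (hyl.eventually (lt_mem_nhds h2)).exists
        exact Set.mem_iUnion.2 ⟨n, ⟨h0, h1, hn.le⟩, hB⟩
    have hmono : Monotone fun n => window t (y n) \ B := fun a b hab =>
      Set.sdiff_subset_sdiff_left (window_mono le_rfl (hy.monotone hab))
    calc volume (window t x \ B)
        ≤ volume (⋃ n, window t (y n) \ B) + volume {x.toReal} :=
          (measure_mono hsub).trans (measure_union_le _ _)
      _ = ⨆ n, volume (window t (y n) \ B) := by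
          rw [hmono.measure_iUnion, Real.volume_singleton, add_zero]
      _ ≤ w := iSup_le hlt

lemma finishTime_le (B : Set ℝ) (t w : ℝ≥0∞) :
    finishTime B t w ≤ t + w + volume (B ∩ window t (finishTime B t w)) := by
  have h1 := volume_window_finishTime_sdiff_le B t w
  set x := finishTime B t w
  have h2 : x - t ≤ w + volume (B ∩ window t x) := by
    rw [← volume_window]
    calc volume (window t x) ≤ volume ((window t x \ B) ∪ (B ∩ window t x)) :=
          measure_mono fun τ hτ => by by_cases hB : τ ∈ B <;> simp [hτ, hB]
      _ ≤ volume (window t x \ B) + volume (B ∩ window t x) := measure_union_le _ _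
      _ ≤ _ := by gcongr
  rw [add_assoc]
  exact tsub_le_iff_left.1 h2

/-- The total service time of a list of operations. -/
def total (ops : List (Component V × ℝ≥0∞)) : ℝ≥0∞ := (ops.map Prod.snd).sum

/-- The service time that a list of operations requires at the component `m`. -/
def load (ops : List (Component V × ℝ≥0∞)) (m : Component V) : ℝ≥0∞ :=
  (ops.map fun o => if o.1 = m then o.2 else 0).sum

/-- The components at which a list of operations takes place. -/
def visited (ops : List (Component V × ℝ≥0∞)) : Finset (Component V) :=
  (ops.map Prod.fst).toFinset

lemma total_cons (o : Component V × ℝ≥0∞) (os : List (Component V × ℝ≥0∞)) :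
    total (o :: os) = o.2 + total os := rfl

lemma load_cons (o : Component V × ℝ≥0∞) (os : List (Component V × ℝ≥0∞)) (m : Component V) :
    load (o :: os) m = (if o.1 = m then o.2 else 0) + load os m := rfl

lemma insert_erase_self {α : Type*} [DecidableEq α] (a : α) (s : Finset α) :
    insert a (s.erase a) = insert a s := by
  ext b
  by_cases h : b = a <;> simp [h]

/-- A job adds no more than its own service time there to the time for which a component is
occupied. -/
lemma volume_execJob_le (ops : List (Component V × ℝ≥0∞)) (t : ℝ≥0∞) (B : Component V → Set ℝ)
    (m : Component V) : volume ((execJob ops t B).2 m) ≤ volume (B m) + load ops m := by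
  induction ops generalizing t B with
  | nil => simp [execJob]
  | cons o os ih =>
    rw [execJob]
    refine (ih _ _).trans ?_
    rw [load_cons, ← add_assoc]
    refine add_le_add_left ?_ _
    by_cases hm : o.1 = m
    · subst hm
      rw [Function.update_self, if_pos rfl, ← Set.union_sdiff_self]
      refine (measure_union_le _ _).trans ?_
      gcongr
      exact volume_window_finishTime_sdiff_le _ _ _
    · rw [Function.update_of_ne (Ne.symm hm), if_neg hm, add_zero]

/-- From time `t` on, a job waits at each component for no longer than the component is occupied by
jobs of higher priority, no matter how often it returns there: its stays do not overlap in time. -/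
lemma execJob_le (ops : List (Component V × ℝ≥0∞)) (t : ℝ≥0∞) (B : Component V → Set ℝ) :
    (execJob ops t B).1 ≤ t + total ops + ∑ m ∈ visited ops, volume (B m ∩ window t ∞) := by
  induction ops generalizing t B with
  | nil => simp [execJob, total, visited]
  | cons o os ih =>
    obtain ⟨m, w⟩ := o
    rw [execJob]
    refine (ih _ _).trans ?_
    simp only
    have hx := finishTime_le (B m) t w
    have htx := le_finishTime (B m) t w
    set x := finishTime (B m) t w
    have hvis : visited ((m, w) :: os) = insert m ((visited os).erase m) := by
      rw [insert_erase_self]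
      simp [visited]
    have h1 : volume (Function.update B m (B m ∪ window t x) m ∩ window x ∞)
        ≤ volume (B m ∩ window x ∞) := by
      rw [Function.update_self, Set.union_inter_distrib_right]
      refine (measure_union_le _ _).trans ?_
      rw [volume_window_inter, add_zero]
    have h2 : volume (B m ∩ window t x) + volume (B m ∩ window x ∞)
        ≤ volume (B m ∩ window t ∞) := by
      rw [← measure_inter_add_sdiff (B m ∩ window t ∞) (measurableSet_window t x)]
      have h3 : B m ∩ window t x ⊆ B m ∩ window t ∞ ∩ window t x := fun τ hτ =>
        ⟨⟨hτ.1, window_mono le_rfl le_top hτ.2⟩, hτ.2⟩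
      have h4 : B m ∩ window x ∞
          ⊆ ((B m ∩ window t ∞) \ window t x) ∪ (window t x ∩ window x ∞) := fun τ hτ => by
        by_cases hw : τ ∈ window t x
        · exact Or.inr ⟨hw, hτ.2⟩
        · exact Or.inl ⟨⟨hτ.1, window_mono htx le_rfl hτ.2⟩, hw⟩
      refine add_le_add (measure_mono h3) ?_
      refine (measure_mono h4).trans ((measure_union_le _ _).trans ?_)
      rw [volume_window_inter, add_zero]
    have h5 : ∑ m' ∈ visited os, volume (Function.update B m (B m ∪ window t x) m' ∩ window x ∞)
        ≤ volume (B m ∩ window x ∞) + ∑ m' ∈ (visited os).erase m, volume (B m' ∩ window t ∞) := by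
      have hsub : visited os ⊆ insert m ((visited os).erase m) := by
        rw [insert_erase_self]
        exact Finset.subset_insert _ _
      refine (Finset.sum_le_sum_of_subset hsub).trans ?_
      rw [Finset.sum_insert (by simp)]
      refine add_le_add h1 (Finset.sum_le_sum fun m' hm' => ?_)
      rw [Function.update_of_ne (Finset.ne_of_mem_erase hm')]
      exact measure_mono (Set.inter_subset_inter_right _ (window_mono htx le_rfl))
    rw [hvis, Finset.sum_insert (by simp), total_cons]
    calc _ ≤ (t + w + volume (B m ∩ window t x)) + total os + (volume (B m ∩ window x ∞)
            + ∑ m' ∈ (visited os).erase m, volume (B m' ∩ window t ∞)) := by gcongr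
      _ = t + (w + total os) + ((volume (B m ∩ window t x) + volume (B m ∩ window x ∞))
            + ∑ m' ∈ (visited os).erase m, volume (B m' ∩ window t ∞)) := by ring
      _ ≤ _ := by gcongr

/-- Under preemptive priority scheduling, each job is delayed at the components that it visits by no
more than the service times there of the jobs of higher priority. -/
lemma execAll_le {n : ℕ} (f : Fin n → List (Component V × ℝ≥0∞)) (B : Component V → Set ℝ)
    (X : ℝ≥0∞) (h : ∀ p, total (f p) + ∑ m ∈ visited (f p),
      (volume (B m) + ∑ p' with p' < p, load (f p') m) ≤ X) :
    execAll (List.ofFn f) B ≤ X := by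
  induction n generalizing B with
  | zero => simp [execAll]
  | succ n ih =>
    rw [List.ofFn_succ, execAll]
    refine max_le ?_ (ih _ _ fun p => le_trans ?_ (h p.succ))
    · refine (execJob_le _ _ _).trans (le_trans ?_ (h 0))
      rw [zero_add]
      gcongr with m hm
      exact (measure_mono Set.inter_subset_left).trans le_self_add
    · refine add_le_add_right (Finset.sum_le_sum fun m _ => ?_) _
      have h1 := volume_execJob_le (f 0) 0 B m
      simp only [Finset.sum_filter, Fin.sum_univ_succ, Fin.succ_pos, if_true, Fin.succ_lt_succ_iff]
      rw [← add_assoc]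
      exact add_le_add_left h1 _

end Execution

/-! ### Lower bounds on the completion time of an arbitrary schedule -/

section LowerBounds

variable {N : Network V} {jobs : Jobs V}

lemma load_eq_sum (ops : List (Component V × ℝ≥0∞)) (m : Component V) :
    load ops m = ∑ i : Fin ops.length with (ops.get i).1 = m, (ops.get i).2 := by
  rw [Finset.sum_filter, load, ← Fin.sum_univ_fun_getElem]
  rfl

lemma total_eq_sum (ops : List (Component V × ℝ≥0∞)) :
    total ops = ∑ i : Fin ops.length, (ops.get i).2 := by
  rw [total, ← Fin.sum_univ_fun_getElem]
  rfl

lemma Schedule.service_le_one (S : Schedule N jobs) (j : Fin jobs.J)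
    (i : Fin (S.route j).ops.length) (τ : ℝ) : S.service j i τ ≤ 1 := by
  refine le_trans ?_ (S.capacity_le ((S.route j).ops.get i).1 τ)
  refine le_trans ?_ (Finset.single_le_sum (fun _ _ => zero_le) (Finset.mem_univ j))
  exact Finset.single_le_sum (f := fun i : Fin (S.route j).ops.length => S.service j i τ)
    (fun _ _ => zero_le) (by simp)

lemma Schedule.time_le_makespan (S : Schedule N jobs) (j : Fin jobs.J) {i : ℕ}
    (hi : i ≤ (S.route j).ops.length) : S.time j i ≤ S.makespan :=
  (S.mono j hi).trans (le_iSup (fun j => S.time j (S.route j).ops.length) j)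

lemma sum_tsub_le_of_monotone {t : ℕ → ℝ≥0∞} (ht : Monotone t) (n : ℕ) :
    ∑ i ∈ Finset.range n, (t (i + 1) - t i) ≤ t n := by
  induction n with
  | zero => simp
  | succ n ih =>
    rw [Finset.sum_range_succ]
    calc _ ≤ t n + (t (n + 1) - t n) := by gcongr
      _ = t (n + 1) := add_tsub_cancel_of_le (ht n.le_succ)

/-- The operations of a job are performed one after the other. -/
lemma Schedule.total_le (S : Schedule N jobs) (j : Fin jobs.J) :
    total (S.route j).ops ≤ S.makespan := by
  refine le_trans ?_ ((sum_tsub_le_of_monotone (S.mono j) _).trans (S.time_le_makespan j le_rfl))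
  rw [total_eq_sum, Finset.sum_range]
  refine Finset.sum_le_sum fun i _ => (S.served j i).trans ?_
  calc ∫⁻ τ in window (S.time j i) (S.time j (i + 1)), S.service j i τ
      ≤ ∫⁻ _ in window (S.time j i) (S.time j (i + 1)), 1 :=
        lintegral_mono fun τ => S.service_le_one j i τ
    _ = _ := by rw [setLIntegral_one, volume_window]

/-- No component performs more work than its capacity admits. -/
lemma Schedule.sum_load_le (S : Schedule N jobs) (m : Component V) :
    ∑ j, load (S.route j).ops m ≤ S.makespan := by
  calc ∑ j, load (S.route j).ops m
      ≤ ∑ j, ∑ i : Fin (S.route j).ops.length with ((S.route j).ops.get i).1 = m,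
          ∫⁻ τ in window 0 S.makespan, S.service j i τ := by
        refine Finset.sum_le_sum fun j _ => ?_
        rw [load_eq_sum]
        refine Finset.sum_le_sum fun i _ => (S.served j i).trans ?_
        exact lintegral_mono_set (window_mono zero_le (S.time_le_makespan j i.2))
    _ = ∫⁻ τ in window 0 S.makespan,
          ∑ j, ∑ i : Fin (S.route j).ops.length with ((S.route j).ops.get i).1 = m,
            S.service j i τ := by
        rw [lintegral_finsetSum]
        · refine Finset.sum_congr rfl fun j _ => ?_
          rw [lintegral_finsetSum]
          exact fun i _ => S.measurable_service j i
        · exact fun j _ => Finset.measurable_sum _ fun i _ => S.measurable_service j i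
    _ ≤ ∫⁻ _ in window 0 S.makespan, 1 := lintegral_mono fun τ => S.capacity_le m τ
    _ = S.makespan := by rw [setLIntegral_one, volume_window, tsub_zero]

open Classical in
/-- The components at which an operation can take a positive finite time: the nodes of positive
computation capacity and the links of finite transmission capacity. -/
def activeComponents (N : Network V) : Finset (Component V) :=
  (Finset.univ.filter fun u => 0 < N.nodeRate u).disjSum
    (N.E.filter fun e => N.linkRate e.1 e.2 ≠ ∞)

lemma card_activeComponents (N : Network V) :
    (activeComponents N).card = numNodes N + numLinks N :=
  Finset.card_disjSum _ _

lemma numNodes_pos (N : Network V) : 0 < numNodes N := by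
  obtain ⟨u, hu⟩ := N.exists_nodeRate_pos
  exact Finset.card_pos.2 ⟨u, by simpa using hu⟩

lemma serviceTime_of_mem_intraEdges {j : Fin jobs.J} {e : jobs.LNode j × jobs.LNode j}
    (he : e ∈ intraEdges N jobs j) :
    serviceTime N jobs j e = (jobs.d j e.1.1 : ℝ≥0∞) / N.linkRate e.1.2 e.2.2 := by
  rw [serviceTime, task, capacity, if_pos (mem_intraEdges.1 he).1, if_pos (mem_intraEdges.1 he).1]

lemma serviceTime_of_mem_crossEdges {j : Fin jobs.J} {e : jobs.LNode j × jobs.LNode j}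
    (he : e ∈ crossEdges jobs j) :
    serviceTime N jobs j e = (jobs.c j e.2.1 : ℝ≥0∞) / N.nodeRate e.1.2 := by
  rw [serviceTime, task, capacity, if_neg (layer_ne_of_mem_crossEdges he),
    if_neg (layer_ne_of_mem_crossEdges he)]

lemma Route.mem_activeComponents {j : Fin jobs.J} (ρ : Route N jobs j)
    {o : Component V × ℝ≥0∞} (ho : o ∈ ρ.ops) (h0 : o.2 ≠ 0) (htop : o.2 ≠ ∞) :
    o.1 ∈ activeComponents N := by
  obtain ⟨e, he, rfl⟩ := List.mem_map.1 ho
  simp only at h0 htop ⊢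
  rcases DNNRouting.mem_layeredEdges.1 (ρ.mem_layeredEdges he) with hi | hc
  · rw [if_pos (mem_intraEdges.1 hi).1, activeComponents, Finset.inr_mem_disjSum,
      Finset.mem_filter]
    refine ⟨(mem_intraEdges.1 hi).2, fun h => h0 ?_⟩
    rw [serviceTime_of_mem_intraEdges hi, h, ENNReal.div_top]
  · rw [if_neg (layer_ne_of_mem_crossEdges hc), activeComponents, Finset.inl_mem_disjSum,
      Finset.mem_filter]
    refine ⟨Finset.mem_univ _, pos_iff_ne_zero.2 fun h => ?_⟩
    rw [serviceTime_of_mem_crossEdges hc, h, ENNReal.coe_zero] at h0 htop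
    by_cases hc0 : jobs.c j e.2.1 = 0
    · simp [hc0] at h0
    · exact htop (ENNReal.div_zero (by simpa using hc0))

/-- The active components share the total work. -/
lemma Schedule.sum_total_le (S : Schedule N jobs) :
    ∑ j, total (S.route j).ops ≤ ((numNodes N : ℝ≥0∞) + numLinks N) * S.makespan := by
  by_cases htop : S.makespan = ∞
  · rw [htop, ENNReal.mul_top]
    · exact le_top
    · have := numNodes_pos N
      simp [this.ne']
  have hj : ∀ j, total (S.route j).ops = ∑ m ∈ activeComponents N, load (S.route j).ops m := by
    intro j
    simp_rw [total_eq_sum, load_eq_sum, Finset.sum_filter]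
    rw [Finset.sum_comm]
    refine Finset.sum_congr rfl fun i _ => ?_
    rw [Finset.sum_ite_eq]
    split_ifs with hi
    · rfl
    · by_contra h0
      refine hi ((S.route j).mem_activeComponents (List.get_mem _ i) h0 ?_)
      refine ne_top_of_le_ne_top htop (le_trans ?_ (S.total_le j))
      rw [total_eq_sum]
      exact Finset.single_le_sum (f := fun i => ((S.route j).ops.get i).2)
        (fun _ _ => zero_le) (Finset.mem_univ i)
  calc ∑ j, total (S.route j).ops
      = ∑ m ∈ activeComponents N, ∑ j, load (S.route j).ops m := by
        rw [Finset.sum_comm]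
        exact Finset.sum_congr rfl fun j _ => hj j
    _ ≤ ∑ m ∈ activeComponents N, S.makespan := Finset.sum_le_sum fun m _ => S.sum_load_le m
    _ = _ := by
        rw [Finset.sum_const, card_activeComponents, nsmul_eq_mul]
        push_cast
        rfl

end LowerBounds

/-! ### Routes as solutions of the single-job problem -/

section Flows

variable {N : Network V} {jobs : Jobs V} {j : Fin jobs.J}

lemma sum_ite_mem_list {α M : Type*} [DecidableEq α] [AddCommMonoid M] {s : Finset α} {l : List α}
    (hnd : l.Nodup) (hl : ∀ a ∈ l, a ∈ s) (f : α → M) :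
    ∑ a ∈ s, (if a ∈ l then f a else 0) = (l.map f).sum := by
  rw [← List.sum_toFinset f hnd, ← Finset.sum_filter]
  congr 1
  ext a
  simpa using hl a

/-- The indicator of the edges of a route. -/
def Route.flow (ρ : Route N jobs j) (e : jobs.LNode j × jobs.LNode j) : ℕ :=
  if e ∈ ρ.steps then 1 else 0

lemma Route.IsGivenBy.eq_flow {ρ : Route N jobs j} {r : jobs.LNode j × jobs.LNode j → ℕ}
    {z : V → ℕ} (h : ρ.IsGivenBy r) (hr : IsFeasible N jobs j r z)
    {e : jobs.LNode j × jobs.LNode j} (he : e ∈ layeredEdges N jobs j) : r e = ρ.flow e := by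
  have h1 := h e he
  rw [Route.flow]
  split_ifs with h2
  · exact h1.2 h2
  · exact (hr.1 e he).resolve_right fun h3 => h2 (h1.1 h3)

lemma sum_mul_flow {ρ : Route N jobs j} (hnd : ρ.steps.Nodup)
    (f : jobs.LNode j × jobs.LNode j → ℝ≥0∞) :
    ∑ e ∈ layeredEdges N jobs j, f e * (ρ.flow e : ℝ≥0∞) = (ρ.steps.map f).sum := by
  rw [← sum_ite_mem_list hnd (fun e he => ρ.mem_layeredEdges he)]
  refine Finset.sum_congr rfl fun e _ => ?_
  simp [Route.flow]

lemma disjoint_intraEdges_crossEdges : Disjoint (intraEdges N jobs j) (crossEdges jobs j) :=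
  Finset.disjoint_left.2 fun _ h1 h2 => layer_ne_of_mem_crossEdges h2 (mem_intraEdges.1 h1).1

lemma sum_intraEdges_mul_flow {ρ : Route N jobs j} (hnd : ρ.steps.Nodup)
    (f : jobs.LNode j × jobs.LNode j → ℝ≥0∞) :
    ∑ e ∈ intraEdges N jobs j, f e * (ρ.flow e : ℝ≥0∞)
      = (ρ.steps.map fun e => if e.1.1 = e.2.1 then f e else 0).sum := by
  rw [← sum_mul_flow hnd, layeredEdges, Finset.sum_union disjoint_intraEdges_crossEdges,
    Finset.sum_eq_zero (s := crossEdges jobs j), add_zero]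
  · exact Finset.sum_congr rfl fun e he => by rw [if_pos (mem_intraEdges.1 he).1]
  · intro e he
    rw [if_neg (layer_ne_of_mem_crossEdges he), zero_mul]

lemma start_ne_target : jobs.start j ≠ jobs.target j := by
  intro h
  have h1 := congrArg (fun a => (a.1 : ℕ)) h
  have h2 := jobs.L_pos j
  simp only [Jobs.start, Jobs.target, Fin.val_zero, Fin.val_last] at h1
  omega

/-- A walk without repeated nodes leaves each node as often as it enters it, except at its ends. -/
lemma Route.isFeasible_flow {ρ : Route N jobs j} (hnd : ρ.nodes.Nodup) {z : V → ℕ}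
    (hz : ∀ u, z u = 0 ∨ z u = 1)
    (hcov : ∀ e ∈ ρ.steps, e.1.1 ≠ e.2.1 → z e.1.2 = 1) :
    IsFeasible N jobs j ρ.flow z := by
  have hsteps : ρ.steps.Nodup := nodup_pairs hnd
  refine ⟨fun e _ => ?_, hz, fun e he => ?_, fun a => ?_⟩
  · rw [Route.flow]
    split_ifs <;> simp
  · rw [Route.flow]
    split_ifs with h
    · exact (hcov e h (layer_ne_of_mem_crossEdges he)).ge
    · exact Nat.zero_le _
  · have key : ∀ g : jobs.LNode j × jobs.LNode j → jobs.LNode j,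
        ∑ e ∈ layeredEdges N jobs j with g e = a, (ρ.flow e : ℤ)
          = ((ρ.steps.map g).count a : ℤ) := by
      intro g
      rw [Finset.sum_filter]
      refine Eq.trans (Finset.sum_congr rfl fun e _ => ?_)
        ((sum_ite_mem_list hsteps (fun e he => ρ.mem_layeredEdges he)
          (fun e => if g e = a then (1 : ℤ) else 0)).trans ?_)
      · by_cases h1 : g e = a <;> by_cases h2 : e ∈ ρ.steps <;> simp [Route.flow, h1, h2]
      generalize ρ.steps = l
      induction l with
      | nil => simp
      | cons b l ih =>
        rw [List.map_cons, List.sum_cons, ih, List.map_cons, List.count_cons]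
        by_cases h : g b = a <;> simp [h, add_comm]
    have h1 : ρ.steps.map Prod.fst = ρ.nodes.dropLast := map_fst_pairs _
    have h2 : ρ.steps.map Prod.snd = ρ.nodes.tail := map_snd_pairs _
    rw [key, key, h1, h2]
    obtain ⟨l₁, hl₁⟩ := ρ.isWalk.eq_append_singleton
    obtain ⟨l₂, hl₂⟩ := ρ.isWalk.eq_cons
    have h3 : l₁.count a + (if jobs.target j = a then 1 else 0)
        = l₂.count a + (if jobs.start j = a then 1 else 0) := by
      have := congrArg (List.count a) (hl₁.symm.trans hl₂)
      simpa [List.count_cons, List.count_append] using this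
    have h4 : ρ.nodes.dropLast = l₁ := by rw [hl₁, List.dropLast_concat]
    have h5 : ρ.nodes.tail = l₂ := by rw [hl₂, List.tail_cons]
    rw [h4, h5]
    have hne := start_ne_target (j := j)
    by_cases ha : a = jobs.start j
    · subst ha
      simp only [hne.symm, if_true, if_false] at h3 ⊢
      omega
    · by_cases hb : a = jobs.target j
      · subst hb
        simp only [hne, ha, if_true, if_false] at h3 ⊢
        omega
      · simp only [Ne.symm ha, Ne.symm hb, ha, hb, if_false] at h3 ⊢
        omega

/-- The time that a component needs to clear its queue. -/
def Queues.delay (N : Network V) (Q : Queues V) : Component V → ℝ≥0∞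
  | Sum.inl u => (Q.node u : ℝ≥0∞) / N.nodeRate u
  | Sum.inr e => (Q.link e.1 e.2 : ℝ≥0∞) / N.linkRate e.1 e.2

lemma objective_flow {ρ : Route N jobs j} (hnd : ρ.steps.Nodup) (Q : Queues V) (z : V → ℕ) :
    objective N jobs j Q ρ.flow z = (ρ.steps.map (serviceTime N jobs j)).sum
      + (ρ.steps.map fun e => if e.1.1 = e.2.1 then Q.delay N (Sum.inr (e.1.2, e.2.2)) else 0).sum
      + ∑ u, Q.delay N (Sum.inl u) * (z u : ℝ≥0∞) := by
  rw [objective, sum_mul_flow hnd, sum_intraEdges_mul_flow hnd]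
  rfl

lemma Route.total_ops (ρ : Route N jobs j) :
    total ρ.ops = (ρ.steps.map (serviceTime N jobs j)).sum := by
  rw [total, Route.ops, List.map_map]
  rfl

lemma objective_congr {r r' : jobs.LNode j × jobs.LNode j → ℕ}
    (h : ∀ e ∈ layeredEdges N jobs j, r e = r' e) (Q : Queues V) (z : V → ℕ) :
    objective N jobs j Q r z = objective N jobs j Q r' z := by
  rw [objective, objective]
  congr 2
  · exact Finset.sum_congr rfl fun e he => by rw [h e he]
  · exact Finset.sum_congr rfl fun e he => by rw [h e (DNNRouting.mem_layeredEdges.2 (Or.inl he))]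

/-- The objective accounts for the service times along the route and for one full queue at each
component visited. -/
lemma total_add_delay_le_objective {ρ : Route N jobs j} (hnd : ρ.steps.Nodup) {z : V → ℕ}
    (hz : IsFeasible N jobs j ρ.flow z) (Q : Queues V) :
    total ρ.ops + ∑ m ∈ visited ρ.ops, Q.delay N m ≤ objective N jobs j Q ρ.flow z := by
  rw [objective_flow hnd, Route.total_ops, add_assoc]
  refine add_le_add_right ?_ _
  have hsub : visited ρ.ops ⊆ (Finset.univ.filter fun u => z u = 1).disjSum
      ((ρ.steps.toFinset.filter fun e => e.1.1 = e.2.1).image fun e => (e.1.2, e.2.2)) := by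
    intro m hm
    rw [visited, List.mem_toFinset, Route.ops, List.map_map, List.mem_map] at hm
    obtain ⟨e, he, rfl⟩ := hm
    simp only [Function.comp_apply]
    split_ifs with h
    · rw [Finset.inr_mem_disjSum, Finset.mem_image]
      exact ⟨e, by simp [he, h], rfl⟩
    · rw [Finset.inl_mem_disjSum, Finset.mem_filter]
      refine ⟨Finset.mem_univ _, ?_⟩
      have h1 := hz.2.2.1 e ((mem_crossEdges_iff (ρ.mem_layeredEdges he)).2 h)
      rw [Route.flow, if_pos he] at h1
      have := hz.2.1 e.1.2
      omega
  refine (Finset.sum_le_sum_of_subset hsub).trans ?_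
  rw [Finset.sum_disjSum, add_comm]
  refine add_le_add ?_ ?_
  · rw [← List.sum_toFinset _ hnd, ← Finset.sum_filter]
    exact Finset.sum_image_le_of_nonneg fun _ _ => zero_le
  · rw [Finset.sum_filter]
    refine Finset.sum_le_sum fun u _ => ?_
    split_ifs with h <;> simp [h]

lemma Route.load_ops {ρ : Route N jobs j} (hnd : ρ.steps.Nodup) (m : Component V) :
    load ρ.ops m = ∑ e ∈ layeredEdges N jobs j,
      (if (if e.1.1 = e.2.1 then Sum.inr (e.1.2, e.2.2) else Sum.inl e.1.2) = m
        then serviceTime N jobs j e else 0) * (ρ.flow e : ℝ≥0∞) := by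
  rw [sum_mul_flow hnd, load, Route.ops, List.map_map]
  rfl

lemma Route.load_ops_inl {ρ : Route N jobs j} (hnd : ρ.steps.Nodup) (u : V) :
    load ρ.ops (Sum.inl u) = (∑ e ∈ crossEdges jobs j with e.1.2 = u,
      (task jobs j e : ℝ≥0∞) * (ρ.flow e : ℝ≥0∞)) / N.nodeRate u := by
  rw [Route.load_ops hnd, layeredEdges, Finset.sum_union disjoint_intraEdges_crossEdges,
    Finset.sum_eq_zero (s := intraEdges N jobs j), zero_add, Finset.sum_filter,
    div_eq_mul_inv, Finset.sum_mul]
  · refine Finset.sum_congr rfl fun e he => ?_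
    rw [if_neg (layer_ne_of_mem_crossEdges he)]
    by_cases h : e.1.2 = u
    · subst h
      rw [if_pos rfl, if_pos rfl, serviceTime, capacity, if_neg (layer_ne_of_mem_crossEdges he),
        div_eq_mul_inv, mul_right_comm]
    · simp [h]
  · intro e he
    rw [if_pos (mem_intraEdges.1 he).1, if_neg (by simp), zero_mul]

lemma Route.load_ops_inr {ρ : Route N jobs j} (hnd : ρ.steps.Nodup) (u v : V) :
    load ρ.ops (Sum.inr (u, v)) = (∑ e ∈ intraEdges N jobs j with e.1.2 = u ∧ e.2.2 = v,
      (task jobs j e : ℝ≥0∞) * (ρ.flow e : ℝ≥0∞)) / N.linkRate u v := by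
  rw [Route.load_ops hnd, layeredEdges, Finset.sum_union disjoint_intraEdges_crossEdges,
    Finset.sum_eq_zero (s := crossEdges jobs j), add_zero, Finset.sum_filter,
    div_eq_mul_inv, Finset.sum_mul]
  · refine Finset.sum_congr rfl fun e he => ?_
    rw [if_pos (mem_intraEdges.1 he).1]
    by_cases h : e.1.2 = u ∧ e.2.2 = v
    · obtain ⟨rfl, rfl⟩ := h
      rw [if_pos rfl, if_pos ⟨rfl, rfl⟩, serviceTime, capacity, if_pos (mem_intraEdges.1 he).1,
        div_eq_mul_inv, mul_right_comm]
    · rw [if_neg h, if_neg (by simpa using h), zero_mul, zero_mul]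
  · intro e he
    rw [if_neg (layer_ne_of_mem_crossEdges he), if_neg (by simp), zero_mul]

end Flows

/-! ### The greedy run -/

section Greedy

variable {N : Network V} {jobs : Jobs V} {G : GreedyRun N jobs} {ρ : ∀ j, Route N jobs j}

/-- The queues with which the greedy run routes the job at position `p`. -/
abbrev GreedyRun.queues (G : GreedyRun N jobs) (p : Fin jobs.J) : Queues V :=
  queuesAt N jobs G.order G.r p

lemma GreedyRun.isFeasible (G : GreedyRun N jobs) (j : Fin jobs.J) :
    IsFeasible N jobs j (G.r j) (G.z j) := by
  have := (G.optimal (G.order.symm j)).1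
  rwa [Equiv.apply_symm_apply] at this

lemma GreedyRun.r_eq_flow (hρ : ∀ j, (ρ j).IsGivenBy (G.r j)) (j : Fin jobs.J)
    {e : jobs.LNode j × jobs.LNode j} (he : e ∈ layeredEdges N jobs j) :
    G.r j e = (ρ j).flow e :=
  (hρ j).eq_flow (G.isFeasible j) he

lemma isFeasible_congr {j : Fin jobs.J} {r r' : jobs.LNode j × jobs.LNode j → ℕ} {z : V → ℕ}
    (h : ∀ e ∈ layeredEdges N jobs j, r e = r' e) (hr : IsFeasible N jobs j r z) :
    IsFeasible N jobs j r' z := by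
  obtain ⟨h1, h2, h3, h4⟩ := hr
  refine ⟨fun e he => h e he ▸ h1 e he, h2, fun e he => ?_, fun a => ?_⟩
  · rw [← h e (mem_layeredEdges.2 (Or.inr he))]
    exact h3 e he
  · rw [← h4 a]
    congr 1 <;> refine Finset.sum_congr rfl fun e he => ?_ <;>
      rw [h e (Finset.mem_filter.1 he).1]

/-- The queues of the greedy run consist of the work of the jobs of higher priority. -/
lemma GreedyRun.sum_load_eq (hρ : ∀ j, (ρ j).IsGivenBy (G.r j)) (hsimple : ∀ j, (ρ j).IsSimple)
    (p : Fin jobs.J) (m : Component V) :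
    ∑ p' with p' < p, load (ρ (G.order p')).ops m = (G.queues p).delay N m := by
  cases m with
  | inl u =>
    simp only [Queues.delay, GreedyRun.queues, queuesAt]
    rw [ENNReal.ofNNReal_finsetSum, div_eq_mul_inv, Finset.sum_mul]
    refine Finset.sum_congr rfl fun p' _ => ?_
    rw [Route.load_ops_inl (Route.nodup_steps (hsimple _)), div_eq_mul_inv,
      ENNReal.ofNNReal_finsetSum]
    congr 1
    refine Finset.sum_congr rfl fun e he => ?_
    rw [← r_eq_flow hρ _ (mem_layeredEdges.2 (Or.inr (Finset.mem_filter.1 he).1))]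
    push_cast
    rfl
  | inr e =>
    obtain ⟨u, v⟩ := e
    simp only [Queues.delay, GreedyRun.queues, queuesAt]
    rw [ENNReal.ofNNReal_finsetSum, div_eq_mul_inv, Finset.sum_mul]
    refine Finset.sum_congr rfl fun p' _ => ?_
    rw [Route.load_ops_inr (Route.nodup_steps (hsimple _)), div_eq_mul_inv,
      ENNReal.ofNNReal_finsetSum]
    congr 1
    refine Finset.sum_congr rfl fun e he => ?_
    rw [← r_eq_flow hρ _ (mem_layeredEdges.2 (Or.inl (Finset.mem_filter.1 he).1))]
    push_cast
    rfl

/-- In the actual system, each job is completed no later than the optimal value of the problem by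
which it was routed. -/
lemma GreedyRun.completionTime_le (hρ : ∀ j, (ρ j).IsGivenBy (G.r j))
    (hsimple : ∀ j, (ρ j).IsSimple) {X : ℝ≥0∞}
    (hX : ∀ p, optValue N jobs (G.order p) (G.queues p) ≤ X) :
    completionTime G.order ρ ≤ X := by
  refine execAll_le _ _ _ fun p => le_trans ?_ (hX p)
  have hflow := fun e he => r_eq_flow (G := G) hρ (G.order p) (e := e) he
  rw [← (G.optimal p).2, objective_congr hflow]
  simp_rw [measure_empty, zero_add, sum_load_eq hρ hsimple]
  exact total_add_delay_le_objective (Route.nodup_steps (hsimple _))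
    (isFeasible_congr hflow (G.optimal p).1) _

/-- The optimal value is at most the cost of any route without repeated nodes that computes only at
nodes of the set `A`. -/
lemma optValue_le {j : Fin jobs.J} (σ : Route N jobs j) (hnd : σ.nodes.Nodup) (A : Finset V)
    (hA : ∀ e ∈ σ.steps, e.1.1 ≠ e.2.1 → e.1.2 ∈ A) (Q : Queues V) :
    optValue N jobs j Q ≤ (σ.steps.map (serviceTime N jobs j)).sum
      + (σ.steps.map fun e => if e.1.1 = e.2.1 then Q.delay N (Sum.inr (e.1.2, e.2.2)) else 0).sum
      + ∑ u ∈ A, Q.delay N (Sum.inl u) := by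
  have hz : IsFeasible N jobs j σ.flow (fun u => if u ∈ A then 1 else 0) :=
    Route.isFeasible_flow hnd (fun u => by by_cases h : u ∈ A <;> simp [h])
      fun e he h => if_pos (hA e he h)
  refine (iInf₂_le_of_le σ.flow _ (iInf_le _ hz)).trans ?_
  rw [objective_flow (nodup_pairs hnd)]
  simp [Finset.sum_ite_mem]

end Greedy

/-! ### Short paths from edge connectivity -/

section Paths

variable {N : Network V} {k : ℕ}

/-- The duality between paths and cuts. If the potential `D` drops by at most `w` along each link,
then at every level below `D s` at least `k` links descend through this level. Integrating over the
levels counts each link with weight at most `w`. -/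
lemma mul_potential_le (hconn : N.IsEdgeConnected k) (w : V → V → ℝ≥0) (D : V → ℝ≥0) {s t : V}
    (hD : D t = 0) (hDw : ∀ a b, (a, b) ∈ N.E → D a ≤ w a b + D b) :
    (k : ℝ≥0) * D s ≤ ∑ e ∈ N.E, w e.1 e.2 := by
  have hcut : ∀ θ ∈ Set.Ico (0 : ℝ) (D s),
      (k : ℝ≥0∞) ≤ ∑ e ∈ N.E, (Set.Ico (D e.2 : ℝ) (D e.1)).indicator 1 θ := by
    intro θ hθ
    have hcard : k ≤ (N.E.filter fun e => (D e.2 : ℝ) ≤ θ ∧ θ < D e.1).card := by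
      by_contra! hlt
      have hreach : ∀ v, θ < D v := by
        intro v
        induction hconn _ (Finset.filter_subset _ _) hlt s v with
        | refl => exact hθ.2
        | tail _ hbc ih =>
          by_contra! hc
          rw [Finset.mem_sdiff] at hbc
          exact hbc.2 (Finset.mem_filter.2 ⟨hbc.1, hc, ih⟩)
      have ht := hreach t
      rw [hD] at ht
      exact absurd hθ.1 (not_le.2 ht)
    simp only [Set.indicator_apply, Set.mem_Ico, Pi.one_apply, Finset.sum_boole]
    exact_mod_cast hcard
  have hint : (k : ℝ≥0∞) * D s ≤ ∑ e ∈ N.E, (w e.1 e.2 : ℝ≥0∞) :=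
    calc (k : ℝ≥0∞) * D s = ∫⁻ _ in Set.Ico (0 : ℝ) (D s), (k : ℝ≥0∞) := by
          rw [setLIntegral_const, Real.volume_Ico, sub_zero, ENNReal.ofReal_coe_nnreal]
      _ ≤ ∫⁻ θ in Set.Ico (0 : ℝ) (D s),
            ∑ e ∈ N.E, (Set.Ico (D e.2 : ℝ) (D e.1)).indicator 1 θ :=
          setLIntegral_mono' measurableSet_Ico hcut
      _ ≤ ∫⁻ θ, ∑ e ∈ N.E, (Set.Ico (D e.2 : ℝ) (D e.1)).indicator 1 θ :=
          setLIntegral_le_lintegral _ _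
      _ = ∑ e ∈ N.E, volume (Set.Ico (D e.2 : ℝ) (D e.1)) := by
          rw [lintegral_finsetSum]
          · exact Finset.sum_congr rfl fun e _ => lintegral_indicator_one measurableSet_Ico
          · exact fun e _ => measurable_one.indicator measurableSet_Ico
      _ ≤ _ := by
          refine Finset.sum_le_sum fun e he => ?_
          rw [Real.volume_Ico]
          refine ENNReal.ofReal_le_of_le_toReal ?_
          rw [ENNReal.coe_toReal, sub_le_iff_le_add]
          exact_mod_cast hDw e.1 e.2 he
  rw [← ENNReal.ofNNReal_finsetSum] at hint
  exact_mod_cast hint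

/-- In a `k`-edge-connected network, a shortest path uses at most the fraction `1 / k` of the total
length of the links. -/
lemma exists_path_mul_le (hk : 1 ≤ k) (hconn : N.IsEdgeConnected k) (w : V → V → ℝ≥0) (s t : V) :
    ∃ p, IsWalk (PAdj N) s t p ∧ p.Nodup ∧
      (k : ℝ≥0) * ((pairs p).map fun e => w e.1 e.2).sum ≤ ∑ e ∈ N.E, w e.1 e.2 := by
  have hmin : ∀ v, ∃ p, (IsWalk (PAdj N) v t p ∧ p.Nodup) ∧
      ∀ q, IsWalk (PAdj N) v t q ∧ q.Nodup →
        ((pairs p).map fun e => w e.1 e.2).sum ≤ ((pairs q).map fun e => w e.1 e.2).sum := by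
    intro v
    obtain ⟨l, hl⟩ : ∃ l, IsWalk (PAdj N) v t l := by
      have h1 := hconn ∅ (Finset.empty_subset _) (by rwa [Finset.card_empty]) v t
      simp only [Finset.sdiff_empty] at h1
      exact exists_isWalk h1
    obtain ⟨p, hp, hnd, -⟩ := hl.exists_nodup
    have hfin : {q | IsWalk (PAdj N) v t q ∧ q.Nodup}.Finite :=
      (List.finite_length_le V (Fintype.card V)).subset fun q hq => hq.2.length_le_card
    obtain ⟨q, hq, hmin⟩ := Set.exists_min_image _
      (fun q => ((pairs q).map fun e => w e.1 e.2).sum) hfin ⟨p, hp, hnd⟩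
    exact ⟨q, hq, fun q' hq' => hmin q' hq'⟩
  choose P hP hPmin using hmin
  refine ⟨P s, (hP s).1, (hP s).2,
    mul_potential_le hconn w (fun v => ((pairs (P v)).map fun e => w e.1 e.2).sum) (t := t) ?_ ?_⟩
  · have := hPmin t [t] ⟨isWalk_singleton t, by simp⟩
    simpa using this
  · intro a b hab
    obtain ⟨q, hq, hnd, hsub⟩ := ((hP b).1.cons (R := PAdj N) hab).exists_nodup
    refine (hPmin a q ⟨hq, hnd⟩).trans (((hsub.map _).sum_le_sum fun _ _ => zero_le).trans ?_)
    obtain ⟨l, hl⟩ := (hP b).1.eq_cons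
    rw [hl, pairs_cons_cons, List.map_cons, List.sum_cons]

/-- Each node has at least `k` outgoing links. -/
lemma mul_card_le_card_links [Nontrivial V] (hconn : N.IsEdgeConnected k) :
    k * Fintype.card V ≤ N.E.card := by
  have hdeg : ∀ v, k ≤ (N.E.filter fun e => e.1 = v).card := by
    intro v
    by_contra! hlt
    obtain ⟨u, hu⟩ := exists_ne v
    rcases (hconn _ (Finset.filter_subset _ _) hlt v u).cases_head with h | ⟨b, hb, -⟩
    · exact hu h.symm
    · rw [Finset.mem_sdiff, Finset.mem_filter] at hb
      exact hb.2 ⟨hb.1, rfl⟩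
  rw [Finset.card_eq_sum_card_fiberwise (f := Prod.fst) (t := Finset.univ) (by simp), mul_comm,
    ← smul_eq_mul, ← Finset.card_univ]
  exact Finset.card_nsmul_le_sum _ _ _ fun v _ => hdeg v

end Paths

/-! ### Routes that compute at a single node -/

section SingleNode

variable {N : Network V} {jobs : Jobs V} {j : Fin jobs.J}

lemma isWalk_cross (jobs : Jobs V) (j : Fin jobs.J) (u : V) :
    IsWalk (fun a b : jobs.LNode j => (b.1 : ℕ) = a.1 + 1 ∧ a.2 = u ∧ b.2 = u)
      (0, u) (Fin.last _, u) ((List.finRange (jobs.L j + 1)).map fun i => (i, u)) := by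
  refine ⟨?_, ?_, ?_⟩
  · rw [List.isChain_iff_getElem]
    intro i hi
    simp
  · rw [List.finRange_succ]
    rfl
  · rw [List.finRange_succ_last]
    simp

/-- The route that follows a simple path to `u`, performs all computations at `u`, and follows a
simple path to the destination. -/
lemma exists_route_through {u : V} {p q : List V} (hp : IsWalk (PAdj N) (jobs.src j) u p)
    (hpn : p.Nodup) (hq : IsWalk (PAdj N) u (jobs.dst j) q) (hqn : q.Nodup) :
    ∃ σ : Route N jobs j, σ.nodes.Nodup ∧ (∀ e ∈ σ.steps, e.1.1 ≠ e.2.1 → e.1.2 = u) ∧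
      ∀ f : V × V → ℝ≥0∞,
        (σ.steps.map fun e => if e.1.1 = e.2.1 then f (e.1.2, e.2.2) else 0).sum
          = ((pairs p).map f).sum + ((pairs q).map f).sum := by
  have hlayer : ∀ (i : Fin (jobs.L j + 1)) {a b : V} {l : List V}, IsWalk (PAdj N) a b l →
      IsWalk (LAdj N jobs j) (i, a) (i, b) (l.map fun v => (i, v)) := fun i a b l h =>
    h.map _ fun x y hxy => mem_layeredEdges.2 (Or.inl (mem_intraEdges.2 ⟨rfl, hxy⟩))
  have hc := isWalk_cross jobs j u
  have hcross : IsWalk (LAdj N jobs j) (0, u) (Fin.last _, u)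
      ((List.finRange (jobs.L j + 1)).map fun i => (i, u)) := by
    refine ⟨hc.chain.imp fun a b h => ?_, hc.head_eq, hc.last_eq⟩
    exact mem_layeredEdges.2 (Or.inr (mem_crossEdges.2 ⟨h.1, h.2.1.trans h.2.2.symm⟩))
  have hcn : ((List.finRange (jobs.L j + 1)).map fun i => (i, u)).Nodup :=
    (List.nodup_finRange _).map fun a b h => (Prod.ext_iff.1 h).1
  have hcmem : ∀ a ∈ (List.finRange (jobs.L j + 1)).map (fun i => (i, u)), a.2 = u := by
    simp
  obtain ⟨p', rfl⟩ := hp.eq_append_singleton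
  obtain ⟨q', rfl⟩ := hq.eq_cons
  obtain ⟨m, hm⟩ := hcross.eq_append_singleton
  obtain ⟨m', hm'⟩ := hcross.eq_cons
  have hpairs := isChain_iff_pairs.1 hc.chain
  rw [hm] at hcross hcn hcmem hpairs
  have h1 := hlayer 0 hp
  have h2 := hlayer (Fin.last _) hq
  rw [List.map_append] at h1
  have h23 := hcross.append (by simpa using h2)
  have hm2 : m ++ (Fin.last (jobs.L j), u) :: q'.map (fun v => (Fin.last (jobs.L j), v))
      = (0, u) :: (m' ++ q'.map fun v => (Fin.last (jobs.L j), v)) := by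
    rw [← List.cons_append, ← hm', hm, List.append_assoc, List.singleton_append]
  have hw := h1.append (by rw [hm2] at h23; exact h23)
  rw [← hm2] at hw
  refine ⟨⟨_, hw.chain, hw.head_eq, hw.last_eq⟩, ?_, ?_⟩
  · have hL := jobs.L_pos j
    have hlast : (0 : Fin (jobs.L j + 1)) ≠ Fin.last _ := fun h => by
      have := congrArg Fin.val h
      simp only [Fin.val_zero, Fin.val_last] at this
      omega
    rw [List.nodup_append] at hpn hcn
    have hqn' := hqn.map (f := fun v => (Fin.last (jobs.L j), v)) fun a b h => (Prod.ext_iff.1 h).2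
    rw [List.map_cons] at hqn'
    refine List.nodup_append.2 ⟨hpn.1.map fun a b h => (Prod.ext_iff.1 h).2,
      List.nodup_append.2 ⟨hcn.1, hqn', ?_⟩, ?_⟩
    · rintro a ha b hb rfl
      have h3 : a = (Fin.last _, u) := by
        refine Prod.ext ?_ (hcmem a (List.mem_append_left _ ha))
        rw [← List.map_cons (f := fun v => (Fin.last (jobs.L j), v)), List.mem_map] at hb
        obtain ⟨v, -, rfl⟩ := hb
        rfl
      exact hcn.2.2 a ha _ (List.mem_singleton_self _) h3
    · rintro a ha b hb rfl
      obtain ⟨v, hv, rfl⟩ := List.mem_map.1 ha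
      rcases List.mem_append.1 hb with h | h
      · have := hcmem _ (List.mem_append_left _ h)
        exact hpn.2.2 v hv u (List.mem_singleton_self _) this
      · rw [← List.map_cons (f := fun v => (Fin.last (jobs.L j), v)), List.mem_map] at h
        obtain ⟨v', -, h⟩ := h
        exact hlast (Prod.ext_iff.1 h).1.symm
  · have hsteps : pairs (p'.map (fun v => ((0 : Fin (jobs.L j + 1)), v))
          ++ (m ++ (Fin.last (jobs.L j), u) :: q'.map (fun v => (Fin.last (jobs.L j), v))))
        = (pairs (p' ++ [u])).map (Prod.map (fun v => (0, v)) fun v => (0, v))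
          ++ (pairs (m ++ [(Fin.last (jobs.L j), u)])
          ++ (pairs (u :: q')).map
            (Prod.map (fun v => (Fin.last _, v)) fun v => (Fin.last _, v))) := by
      rw [hm2, pairs_append_cons, ← hm2, pairs_append_cons m, ← pairs_map, ← pairs_map,
        List.map_append]
      rfl
    have hne : ∀ e ∈ pairs (m ++ [(Fin.last (jobs.L j), u)]), e.1.1 ≠ e.2.1 := by
      intro e he h
      have := (hpairs e he).1
      rw [h] at this
      omega
    constructor
    · intro e he hne'
      rw [Route.steps, ← pairs, hsteps, List.mem_append, List.mem_append] at he
      rcases he with he | he | he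
      · obtain ⟨x, -, rfl⟩ := List.mem_map.1 he
        exact absurd rfl hne'
      · exact (hpairs e he).2.1
      · obtain ⟨x, -, rfl⟩ := List.mem_map.1 he
        exact absurd rfl hne'
    · intro f
      rw [Route.steps, ← pairs, hsteps, List.map_append, List.map_append, List.sum_append,
        List.sum_append, List.map_map, List.map_map]
      have h0 : ((pairs (m ++ [(Fin.last (jobs.L j), u)])).map
          fun e => if e.1.1 = e.2.1 then f (e.1.2, e.2.2) else 0).sum = 0 := by
        refine List.sum_eq_zero fun x hx => ?_
        obtain ⟨e, he, rfl⟩ := List.mem_map.1 hx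
        rw [if_neg (hne e he)]
      rw [h0, zero_add]
      simp [Function.comp_def]

end SingleNode

/-! ### Bounds on the work along a route -/

section Work

variable {N : Network V} {jobs : Jobs V} {j : Fin jobs.J}

/-- The largest transmission capacity of a link. -/
abbrev Network.maxLink (N : Network V) : ℝ≥0∞ := ⨆ e ∈ N.E, N.linkRate e.1 e.2

/-- The smallest transmission capacity of a link. -/
abbrev Network.minLink (N : Network V) : ℝ≥0∞ := ⨅ e ∈ N.E, N.linkRate e.1 e.2

/-- The largest computation capacity of a node. -/
abbrev Network.maxNode (N : Network V) : ℝ≥0∞ :=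
  ⨆ (u) (_ : 0 < N.nodeRate u), (N.nodeRate u : ℝ≥0∞)

/-- The smallest positive computation capacity of a node. -/
abbrev Network.minNode (N : Network V) : ℝ≥0∞ :=
  ⨅ (u) (_ : 0 < N.nodeRate u), (N.nodeRate u : ℝ≥0∞)

/-- The largest data size. -/
abbrev Jobs.maxData (jobs : Jobs V) : ℝ≥0∞ := ⨆ (j) (l) (_ : l ≤ jobs.L j), (jobs.d j l : ℝ≥0∞)

/-- The smallest data size. -/
abbrev Jobs.minData (jobs : Jobs V) : ℝ≥0∞ := ⨅ (j) (l) (_ : l ≤ jobs.L j), (jobs.d j l : ℝ≥0∞)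

/-- An upper bound on the time of a single transmission. -/
def maxHop (N : Network V) (jobs : Jobs V) : ℝ≥0∞ := jobs.maxData / N.minLink

/-- A lower bound on the time of a single transmission. -/
def minHop (N : Network V) (jobs : Jobs V) : ℝ≥0∞ := jobs.minData / N.maxLink

/-- The total computational load of a job. -/
def Jobs.work (jobs : Jobs V) (j : Fin jobs.J) : ℝ≥0∞ :=
  ∑ i ∈ Finset.range (jobs.L j), (jobs.c j (i + 1) : ℝ≥0∞)

lemma serviceTime_le_maxHop {e : jobs.LNode j × jobs.LNode j} (he : e ∈ intraEdges N jobs j) :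
    serviceTime N jobs j e ≤ maxHop N jobs := by
  rw [serviceTime_of_mem_intraEdges he]
  exact ENNReal.div_le_div
    (le_iSup_of_le j (le_iSup₂_of_le (e.1.1 : ℕ) (Nat.lt_succ_iff.1 e.1.1.2) le_rfl))
    (iInf₂_le (f := fun e (_ : e ∈ N.E) => N.linkRate e.1 e.2) (e.1.2, e.2.2)
      (mem_intraEdges.1 he).2)

lemma minHop_le_serviceTime {e : jobs.LNode j × jobs.LNode j} (he : e ∈ intraEdges N jobs j) :
    minHop N jobs ≤ serviceTime N jobs j e := by
  rw [serviceTime_of_mem_intraEdges he]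
  exact ENNReal.div_le_div
    (iInf_le_of_le j (iInf₂_le_of_le (e.1.1 : ℕ) (Nat.lt_succ_iff.1 e.1.1.2) le_rfl))
    (le_iSup₂ (f := fun e (_ : e ∈ N.E) => N.linkRate e.1 e.2) (e.1.2, e.2.2)
      (mem_intraEdges.1 he).2)

lemma Route.sum_ite_intra (ρ : Route N jobs j) (x : ℝ≥0∞) :
    (ρ.steps.map fun e => if e.1.1 = e.2.1 then x else 0).sum = ρ.hops * x := by
  rw [Route.hops]
  generalize ρ.steps = l
  induction l with
  | nil => simp
  | cons e l ih =>
    rw [List.map_cons, List.sum_cons, ih]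
    by_cases h : e.1.1 = e.2.1
    · rw [if_pos h, List.filter_cons_of_pos (by simpa using h), List.length_cons]
      push_cast
      ring
    · rw [if_neg h, List.filter_cons_of_neg (by simpa using h), zero_add]

lemma Route.sum_ite_cross (ρ : Route N jobs j) (x : ℝ≥0∞) :
    (ρ.steps.map fun e => if e.1.1 = e.2.1 then 0 else (jobs.c j e.2.1 : ℝ≥0∞) / x).sum
      = jobs.work j / x := by
  refine (sum_cross_of_isWalk ρ.isWalk fun l => (jobs.c j l : ℝ≥0∞) / x).2.trans ?_
  simp only [Jobs.start, Jobs.target, Fin.val_zero, Fin.val_last, ← Finset.range_eq_Ico]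
  rw [Jobs.work, div_eq_mul_inv, Finset.sum_mul]
  rfl

lemma Route.sum_serviceTime (ρ : Route N jobs j) :
    (ρ.steps.map (serviceTime N jobs j)).sum
      = (ρ.steps.map fun e => if e.1.1 = e.2.1 then serviceTime N jobs j e else 0).sum
        + (ρ.steps.map fun e => if e.1.1 = e.2.1 then 0 else serviceTime N jobs j e).sum := by
  rw [← List.sum_map_add]
  congr 1
  refine List.map_congr_left fun e _ => ?_
  split_ifs <;> simp

lemma Route.sum_intra_le (ρ : Route N jobs j) :
    (ρ.steps.map fun e => if e.1.1 = e.2.1 then serviceTime N jobs j e else 0).sum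
      ≤ ρ.hops * maxHop N jobs := by
  rw [← ρ.sum_ite_intra]
  refine List.sum_le_sum fun e he => ?_
  split_ifs with h
  · exact serviceTime_le_maxHop ((mem_intraEdges_iff (ρ.mem_layeredEdges he)).2 h)
  · exact le_rfl

lemma serviceTime_le_div_minNode {e : jobs.LNode j × jobs.LNode j} (he : e ∈ crossEdges jobs j)
    (hpos : 0 < N.nodeRate e.1.2) :
    serviceTime N jobs j e ≤ (jobs.c j e.2.1 : ℝ≥0∞) / N.minNode := by
  rw [serviceTime_of_mem_crossEdges he]
  exact ENNReal.div_le_div le_rfl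
    (iInf₂_le (f := fun u (_ : 0 < N.nodeRate u) => (N.nodeRate u : ℝ≥0∞)) _ hpos)

lemma Route.sum_cross_le (ρ : Route N jobs j)
    (hpos : ∀ e ∈ ρ.steps, e.1.1 ≠ e.2.1 → 0 < N.nodeRate e.1.2) :
    (ρ.steps.map fun e => if e.1.1 = e.2.1 then 0 else serviceTime N jobs j e).sum
      ≤ jobs.work j / N.minNode := by
  rw [← ρ.sum_ite_cross]
  refine List.sum_le_sum fun e he => ?_
  split_ifs with h
  · exact le_rfl
  · exact serviceTime_le_div_minNode ((mem_crossEdges_iff (ρ.mem_layeredEdges he)).2 h)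
      (hpos e he h)

/-- Every route has at least `h_S` transmissions and carries out all the computations. -/
lemma Route.le_total_ops (ρ : Route N jobs j) :
    hShort N jobs * minHop N jobs + jobs.work j / N.maxNode ≤ total ρ.ops := by
  rw [ρ.total_ops, ρ.sum_serviceTime]
  refine add_le_add ?_ ?_
  · calc (hShort N jobs : ℝ≥0∞) * minHop N jobs ≤ ρ.hops * minHop N jobs := by
          gcongr
          exact ρ.hShort_le_hops
      _ ≤ _ := by
          rw [← ρ.sum_ite_intra]
          refine List.sum_le_sum fun e he => ?_
          split_ifs with h
          · exact minHop_le_serviceTime ((mem_intraEdges_iff (ρ.mem_layeredEdges he)).2 h)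
          · exact le_rfl
  · rw [← ρ.sum_ite_cross]
    refine List.sum_le_sum fun e he => ?_
    split_ifs with h
    · exact le_rfl
    · rw [serviceTime_of_mem_crossEdges ((mem_crossEdges_iff (ρ.mem_layeredEdges he)).2 h)]
      refine ENNReal.div_le_div le_rfl ?_
      rcases eq_or_ne (N.nodeRate e.1.2) 0 with h0 | h0
      · simp [h0]
      · exact le_iSup₂ (f := fun u (_ : 0 < N.nodeRate u) => (N.nodeRate u : ℝ≥0∞)) e.1.2
          (pos_iff_ne_zero.2 h0)

lemma sum_load_eq_sum_ite (ops : List (Component V × ℝ≥0∞)) (A : Finset (Component V)) :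
    ∑ m ∈ A, load ops m = (ops.map fun o => if o.1 ∈ A then o.2 else 0).sum := by
  induction ops with
  | nil => simp [load]
  | cons o os ih =>
    simp_rw [load_cons, Finset.sum_add_distrib, ih, Finset.sum_ite_eq, List.map_cons,
      List.sum_cons]

/-- The nodes of positive computation capacity. -/
def Network.computing (N : Network V) : Finset V := Finset.univ.filter fun u => 0 < N.nodeRate u

lemma Route.sum_load_inr_le (ρ : Route N jobs j) :
    ∑ e ∈ N.E, load ρ.ops (Sum.inr e) ≤ ρ.hops * maxHop N jobs := by
  refine le_trans (le_of_eq ?_) (le_trans (List.sum_le_sum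
    (f := fun e => if (if e.1.1 = e.2.1 then Sum.inr (e.1.2, e.2.2) else Sum.inl e.1.2)
      ∈ N.E.map (⟨Sum.inr, Sum.inr_injective⟩ : V × V ↪ Component V)
      then serviceTime N jobs j e else 0) fun e he => ?_) ρ.sum_intra_le)
  · have := sum_load_eq_sum_ite ρ.ops (N.E.map ⟨Sum.inr, Sum.inr_injective⟩)
    rw [Finset.sum_map, Route.ops, List.map_map] at this
    exact this
  · by_cases h : e.1.1 = e.2.1
    · simp only [if_pos h]
      split_ifs <;> simp
    · simp [h]

lemma Route.sum_load_inl_le (ρ : Route N jobs j) :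
    ∑ u ∈ N.computing, load ρ.ops (Sum.inl u) ≤ jobs.work j / N.minNode := by
  rw [← ρ.sum_ite_cross]
  refine le_trans (le_of_eq ?_) (List.sum_le_sum
    (f := fun e => if (if e.1.1 = e.2.1 then Sum.inr (e.1.2, e.2.2) else Sum.inl e.1.2)
      ∈ N.computing.map (⟨Sum.inl, Sum.inl_injective⟩ : V ↪ Component V)
      then serviceTime N jobs j e else 0) fun e he => ?_)
  · have := sum_load_eq_sum_ite ρ.ops (N.computing.map ⟨Sum.inl, Sum.inl_injective⟩)
    rw [Finset.sum_map, Route.ops, List.map_map] at this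
    exact this
  · by_cases h : e.1.1 = e.2.1
    · simp [h]
    · simp only [if_neg h]
      split_ifs with h1
      · refine serviceTime_le_div_minNode ((mem_crossEdges_iff (ρ.mem_layeredEdges he)).2 h) ?_
        simpa [Network.computing] using h1
      · exact zero_le

end Work

/-! ### The optimal value with given queues -/

section Average

variable {N : Network V} {jobs : Jobs V} {j : Fin jobs.J} {k : ℕ}

lemma exists_path_delay_le (hk : 1 ≤ k) (hconn : N.IsEdgeConnected k) (Q : Queues V) (s t : V) :
    ∃ p, IsWalk (PAdj N) s t p ∧ p.Nodup ∧ ((pairs p).map fun e => Q.delay N (Sum.inr e)).sum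
      ≤ (∑ e ∈ N.E, Q.delay N (Sum.inr e)) / k := by
  obtain ⟨p, hp, hnd, hle⟩ := exists_path_mul_le hk hconn
    (fun u v => (Q.delay N (Sum.inr (u, v))).toNNReal) s t
  have hfin : ∀ e ∈ N.E, ((Q.delay N (Sum.inr e)).toNNReal : ℝ≥0∞) = Q.delay N (Sum.inr e) :=
    fun e he => ENNReal.coe_toNNReal (ENNReal.div_ne_top ENNReal.coe_ne_top
      (N.linkRate_pos e.1 e.2 he).ne')
  refine ⟨p, hp, hnd, ?_⟩
  have hk0 : (k : ℝ≥0∞) ≠ 0 := by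
    rw [Nat.cast_ne_zero]
    omega
  rw [ENNReal.le_div_iff_mul_le (Or.inl hk0) (Or.inl (ENNReal.natCast_ne_top k)), mul_comm]
  have h1 : ((pairs p).map fun e => Q.delay N (Sum.inr e))
      = ((pairs p).map fun e => (Q.delay N (Sum.inr e)).toNNReal).map ENNReal.ofNNReal := by
    rw [List.map_map]
    exact List.map_congr_left fun e he => (hfin e (isChain_iff_pairs.1 hp.chain e he)).symm
  have h2 : ∀ l : List ℝ≥0, (l.map ENNReal.ofNNReal).sum = ((l.sum : ℝ≥0) : ℝ≥0∞) := by
    intro l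
    induction l with
    | nil => simp
    | cons a l ih => simp [ih]
  rw [h1, h2, ← Finset.sum_congr rfl hfin, ← ENNReal.ofNNReal_finsetSum]
  exact_mod_cast hle

/-- Computing everything at a node whose queue is at most the average, and going there and on to the
destination by short paths. -/
lemma optValue_le_average (hk : 1 ≤ k) (hconn : N.IsEdgeConnected k) (Q : Queues V) :
    optValue N jobs j Q ≤ 2 * Fintype.card V * maxHop N jobs + jobs.work j / N.minNode
      + 2 * ((∑ e ∈ N.E, Q.delay N (Sum.inr e)) / k)
      + (∑ u ∈ N.computing, Q.delay N (Sum.inl u)) / numNodes N := by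
  have hne : N.computing.Nonempty := Finset.card_pos.1 (numNodes_pos N)
  obtain ⟨u, hu, hmin⟩ := Finset.exists_min_image N.computing (fun u => Q.delay N (Sum.inl u)) hne
  have havg : Q.delay N (Sum.inl u)
      ≤ (∑ u ∈ N.computing, Q.delay N (Sum.inl u)) / numNodes N := by
    rw [ENNReal.le_div_iff_mul_le (Or.inl (by simpa using (numNodes_pos N).ne'))
      (Or.inl (ENNReal.natCast_ne_top _)), mul_comm, ← nsmul_eq_mul]
    exact Finset.card_nsmul_le_sum _ _ _ hmin
  obtain ⟨p, hp, hpn, hpd⟩ := exists_path_delay_le hk hconn Q (jobs.src j) u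
  obtain ⟨q, hq, hqn, hqd⟩ := exists_path_delay_le hk hconn Q u (jobs.dst j)
  obtain ⟨σ, hσ, hσu, hσf⟩ := exists_route_through (j := j) hp hpn hq hqn
  have hhops : (σ.hops : ℝ≥0∞) ≤ 2 * Fintype.card V := by
    have h1 := hσf fun _ => 1
    rw [σ.sum_ite_intra, mul_one] at h1
    have h2 := hpn.length_le_card
    have h3 := hqn.length_le_card
    rw [h1, two_mul]
    simp only [List.map_const', List.sum_replicate, nsmul_eq_mul, mul_one, length_pairs]
    gcongr <;> omega
  refine (optValue_le σ hσ {u} (fun e he h => by simp [hσu e he h]) Q).trans ?_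
  rw [σ.sum_serviceTime, hσf fun e => Q.delay N (Sum.inr e), Finset.sum_singleton, two_mul (_ / _)]
  refine add_le_add (add_le_add (add_le_add ?_ ?_) (add_le_add hpd hqd)) havg
  · exact σ.sum_intra_le.trans (by gcongr)
  · refine σ.sum_cross_le fun e he h => ?_
    rw [hσu e he h]
    exact (Finset.mem_filter.1 hu).2

end Average

/-! ### Comparison with an arbitrary schedule -/

section Comparison

variable {N : Network V} {jobs : Jobs V} {G : GreedyRun N jobs} {ρ : ∀ j, Route N jobs j}

lemma GreedyRun.sum_delay_inr_le (hρ : ∀ j, (ρ j).IsGivenBy (G.r j))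
    (hsimple : ∀ j, (ρ j).IsSimple) (p : Fin jobs.J) :
    ∑ e ∈ N.E, (G.queues p).delay N (Sum.inr e)
      ≤ ∑ p' : Fin jobs.J with p' < p, hLong N jobs * maxHop N jobs := by
  simp_rw [← sum_load_eq hρ hsimple]
  rw [Finset.sum_comm]
  refine Finset.sum_le_sum fun p' _ => (ρ _).sum_load_inr_le.trans ?_
  gcongr
  exact Route.hops_le_hLong (hsimple _)

lemma GreedyRun.sum_delay_inl_le (hρ : ∀ j, (ρ j).IsGivenBy (G.r j))
    (hsimple : ∀ j, (ρ j).IsSimple) (p : Fin jobs.J) :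
    ∑ u ∈ N.computing, (G.queues p).delay N (Sum.inl u)
      ≤ ∑ p' with p' < p, jobs.work (G.order p') / N.minNode := by
  simp_rw [← sum_load_eq hρ hsimple]
  rw [Finset.sum_comm]
  exact Finset.sum_le_sum fun p' _ => (ρ _).sum_load_inl_le

/-- The estimate behind the factor `2 - 1 / m` of list scheduling: a job that has to wait for the
average over `m` machines of the work ahead of it ends before `T + (1 - 1 / m) T`, because both its
own length and the average of all the work are lower bounds on `T`. -/
lemma add_sum_div_le {n : ℕ} (x : Fin n → ℝ≥0∞) (order : Equiv.Perm (Fin n)) (p : Fin n)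
    {m T : ℝ≥0∞} (hm : 1 ≤ m) (hm' : m ≠ ∞) (hx : ∀ j, x j ≤ T) (hsum : ∑ j, x j ≤ m * T) :
    x (order p) + (∑ p' with p' < p, x (order p')) / m ≤ (2 - 1 / m) * T := by
  have hi : 1 / m ≤ 1 := by
    rw [one_div]
    exact ENNReal.inv_le_one.2 hm
  have hm0 : m ≠ 0 := (zero_lt_one.trans_le hm).ne'
  have h2 : (2 : ℝ≥0∞) - 1 / m = 1 + (1 - 1 / m) := by
    rw [← one_add_one_eq_two, (ENNReal.cancel_of_ne (ne_top_of_le_ne_top ENNReal.one_ne_top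
      hi)).add_tsub_assoc_of_le hi]
  have hsplit : 1 / m + (1 - 1 / m) = 1 := add_tsub_cancel_of_le hi
  have hall : x (order p) + ∑ p' with p' < p, x (order p') ≤ m * T := by
    rw [← Finset.sum_insert (f := fun p' => x (order p')) (by simp)]
    refine (Finset.sum_le_sum_of_subset (Finset.subset_univ _)).trans ?_
    rwa [Equiv.sum_comp order x]
  calc x (order p) + (∑ p' with p' < p, x (order p')) / m
      = (1 / m + (1 - 1 / m)) * x (order p) + (∑ p' with p' < p, x (order p')) / m := by
        rw [hsplit, one_mul]
    _ = 1 / m * (x (order p) + ∑ p' with p' < p, x (order p')) + (1 - 1 / m) * x (order p) := by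
        rw [one_div, div_eq_mul_inv]
        ring
    _ ≤ 1 / m * (m * T) + (1 - 1 / m) * T := by
        gcongr
        exact hx _
    _ = (2 - 1 / m) * T := by
        rw [← mul_assoc, ENNReal.div_mul_cancel hm0 hm', h2, add_mul]

/-- The terms of `optValue_le_average` compared, job by job, with the lower bound of
`Route.le_total_ops`. The four hypotheses on `α₀` are the inequalities for the computations of the
job itself, the computations of the jobs ahead of it, its own transmissions, and the transmissions
of the jobs ahead of it. -/
lemma GreedyRun.optValue_le_mul_makespan {k : ℕ} (hk : 1 ≤ k) (hconn : N.IsEdgeConnected k)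
    (hρ : ∀ j, (ρ j).IsGivenBy (G.r j)) (hsimple : ∀ j, (ρ j).IsSimple) (p : Fin jobs.J)
    (S : Schedule N jobs) {α₀ : ℝ≥0∞}
    (h1 : ∀ j, jobs.work j / N.minNode ≤ α₀ * (jobs.work j / N.maxNode))
    (h2 : ∀ j, jobs.work j / N.minNode / numNodes N
      ≤ α₀ * (jobs.work j / N.maxNode / ((numNodes N : ℝ≥0∞) + numLinks N)))
    (h3 : 2 * Fintype.card V * maxHop N jobs ≤ α₀ * (hShort N jobs * minHop N jobs))
    (h4 : 2 * (hLong N jobs * maxHop N jobs / k)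
      ≤ α₀ * (hShort N jobs * minHop N jobs / ((numNodes N : ℝ≥0∞) + numLinks N))) :
    optValue N jobs (G.order p) (G.queues p)
      ≤ α₀ * (2 - 1 / ((numNodes N : ℝ≥0∞) + numLinks N)) * S.makespan := by
  set m : ℝ≥0∞ := (numNodes N : ℝ≥0∞) + numLinks N with hm
  have hm1 : 1 ≤ m := by
    have : (1 : ℝ≥0∞) ≤ numNodes N := by exact_mod_cast numNodes_pos N
    exact this.trans le_self_add
  have hmtop : m ≠ ∞ := by simp [hm]
  set b := hShort N jobs * minHop N jobs with hb
  have hx : ∀ j, b + jobs.work j / N.maxNode ≤ total (S.route j).ops := fun j =>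
    (S.route j).le_total_ops
  calc optValue N jobs (G.order p) (G.queues p)
      ≤ 2 * Fintype.card V * maxHop N jobs + jobs.work (G.order p) / N.minNode
        + 2 * ((∑ p' : Fin jobs.J with p' < p, hLong N jobs * maxHop N jobs) / k)
        + (∑ p' with p' < p, jobs.work (G.order p') / N.minNode) / numNodes N := by
        refine (optValue_le_average hk hconn _).trans ?_
        gcongr
        · exact sum_delay_inr_le hρ hsimple p
        · exact sum_delay_inl_le hρ hsimple p
    _ = 2 * Fintype.card V * maxHop N jobs + jobs.work (G.order p) / N.minNode
        + ∑ p' with p' < p, (2 * (hLong N jobs * maxHop N jobs / k)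
          + jobs.work (G.order p') / N.minNode / numNodes N) := by
        have e1 : 2 * ((∑ p' : Fin jobs.J with p' < p, hLong N jobs * maxHop N jobs) / k)
            = ∑ p' : Fin jobs.J with p' < p, 2 * (hLong N jobs * maxHop N jobs / k) := by
          rw [div_eq_mul_inv, Finset.sum_mul, Finset.mul_sum]
          rfl
        have e2 : (∑ p' with p' < p, jobs.work (G.order p') / N.minNode) / numNodes N
            = ∑ p' with p' < p, jobs.work (G.order p') / N.minNode / numNodes N := by
          rw [div_eq_mul_inv, Finset.sum_mul]
          rfl
        rw [e1, e2, Finset.sum_add_distrib, add_assoc]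
    _ ≤ α₀ * b + α₀ * (jobs.work (G.order p) / N.maxNode)
        + ∑ p' with p' < p, (α₀ * (b / m) + α₀ * (jobs.work (G.order p') / N.maxNode / m)) :=
        add_le_add (add_le_add h3 (h1 _)) (Finset.sum_le_sum fun p' _ => add_le_add h4 (h2 _))
    _ = α₀ * ((b + jobs.work (G.order p) / N.maxNode)
        + (∑ p' with p' < p, (b + jobs.work (G.order p') / N.maxNode)) / m) := by
        simp_rw [div_eq_mul_inv _ m, Finset.sum_mul, mul_add, Finset.mul_sum, add_mul, mul_add]
    _ ≤ α₀ * (total (S.route (G.order p)).ops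
        + (∑ p' with p' < p, total (S.route (G.order p')).ops) / m) := by
        gcongr
        · exact hx _
        · exact hx _
    _ ≤ α₀ * ((2 - 1 / m) * S.makespan) := by
        gcongr
        exact add_sum_div_le (fun j => total (S.route j).ops) G.order p hm1 hmtop S.total_le
          S.sum_total_le
    _ = _ := (mul_assoc _ _ _).symm

/-- If jobs can be finished in arbitrarily short time, then there are routes that take no time at
all, since there are only finitely many edges. -/
lemma exists_route_of_optTime_eq_zero (h : optTime N jobs = 0) (j : Fin jobs.J) :
    ∃ σ : Route N jobs j, σ.nodes.Nodup ∧ ∀ e ∈ σ.steps, serviceTime N jobs j e = 0 := by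
  obtain ⟨σ, hσ⟩ : ∃ σ : Route N jobs j, ∀ e ∈ σ.steps, serviceTime N jobs j e = 0 := by
    by_contra! hc
    set ε := ((layeredEdges N jobs j).filter fun e => serviceTime N jobs j e ≠ 0).inf
      (serviceTime N jobs j) with hε
    have hpos : 0 < ε := by
      rw [hε, Finset.lt_inf_iff ENNReal.zero_lt_top]
      exact fun e he => pos_iff_ne_zero.2 (Finset.mem_filter.1 he).2
    have hle : ε ≤ optTime N jobs := by
      refine le_iInf fun S => le_trans ?_ (S.total_le j)
      obtain ⟨e, he, hne⟩ := hc (S.route j)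
      refine (Finset.inf_le (Finset.mem_filter.2
        ⟨(S.route j).mem_layeredEdges he, hne⟩)).trans ?_
      rw [Route.total_ops]
      exact List.single_le_sum (fun _ _ => zero_le) _ (List.mem_map_of_mem he)
    exact (hpos.trans_le hle).ne' h
  obtain ⟨l, hl, hnd, hsub⟩ := σ.isWalk.exists_nodup
  exact ⟨⟨l, hl.chain, hl.head_eq, hl.last_eq⟩, hnd, fun e he => hσ e (hsub.subset he)⟩

lemma maxNode_ne_top (N : Network V) : N.maxNode ≠ ∞ := by
  refine ne_top_of_le_ne_top (b := ∑ u, (N.nodeRate u : ℝ≥0∞)) (by simp) ?_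
  exact iSup₂_le fun u _ => Finset.single_le_sum (f := fun u => (N.nodeRate u : ℝ≥0∞))
    (fun _ _ => zero_le) (Finset.mem_univ u)

lemma maxNode_ne_zero (N : Network V) : N.maxNode ≠ 0 := by
  obtain ⟨u, hu⟩ := N.exists_nodeRate_pos
  refine ((ENNReal.coe_pos.2 hu).trans_le ?_).ne'
  exact le_iSup₂ (f := fun u (_ : 0 < N.nodeRate u) => (N.nodeRate u : ℝ≥0∞)) u hu

lemma minNode_ne_top (N : Network V) : N.minNode ≠ ∞ := by
  obtain ⟨u, hu⟩ := N.exists_nodeRate_pos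
  exact ne_top_of_le_ne_top ENNReal.coe_ne_top
    (iInf₂_le (f := fun u (_ : 0 < N.nodeRate u) => (N.nodeRate u : ℝ≥0∞)) u hu)

lemma minNode_ne_zero (N : Network V) : N.minNode ≠ 0 := by
  have hne : N.computing.Nonempty := Finset.card_pos.1 (numNodes_pos N)
  obtain ⟨u, hu, hmin⟩ := Finset.exists_min_image N.computing N.nodeRate hne
  refine ((ENNReal.coe_pos.2 (Finset.mem_filter.1 hu).2).trans_le ?_).ne'
  exact le_iInf₂ fun v hv => ENNReal.coe_le_coe.2
    (hmin v (Finset.mem_filter.2 ⟨Finset.mem_univ v, hv⟩))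

lemma work_eq_zero_of_optTime_eq_zero (h : optTime N jobs = 0) (j : Fin jobs.J) :
    jobs.work j = 0 := by
  have hle : jobs.work j / N.maxNode ≤ optTime N jobs := le_iInf fun S =>
    (le_add_self.trans (S.route j).le_total_ops).trans (S.total_le j)
  rw [h, nonpos_iff_eq_zero, ENNReal.div_eq_zero_iff] at hle
  exact hle.resolve_right (maxNode_ne_top N)

/-- Without any loads, nodes have no queues, and queues at links of infinite capacity cause no
delay; so the greedy algorithm finds routes that take no time as well. -/
lemma GreedyRun.completionTime_eq_zero (hρ : ∀ j, (ρ j).IsGivenBy (G.r j))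
    (hsimple : ∀ j, (ρ j).IsSimple) (h : optTime N jobs = 0) :
    completionTime G.order ρ = 0 := by
  refine nonpos_iff_eq_zero.1 (completionTime_le hρ hsimple fun p => ?_)
  obtain ⟨σ, hσ, hσ0⟩ := exists_route_of_optTime_eq_zero h (G.order p)
  refine (optValue_le σ hσ Finset.univ (fun e _ _ => Finset.mem_univ _) _).trans ?_
  have hsum : ∀ l : List ℝ≥0∞, (∀ x ∈ l, x = 0) → l.sum = 0 := fun l hl => List.sum_eq_zero hl
  rw [hsum, hsum, Finset.sum_eq_zero]
  · simp
  · intro u _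
    have hnode : (G.queues p).node u = 0 := by
      simp only [GreedyRun.queues, queuesAt]
      refine Finset.sum_eq_zero fun p' _ => Finset.sum_eq_zero fun e he => ?_
      have hcross := (Finset.mem_filter.1 he).1
      have hlayer := (mem_crossEdges.1 hcross).1
      have hw := work_eq_zero_of_optTime_eq_zero h (G.order p')
      rw [Jobs.work, Finset.sum_eq_zero_iff] at hw
      have hc := hw e.1.1 (Finset.mem_range.2 (by have := e.2.1.2; omega))
      rw [← hlayer, ENNReal.coe_eq_zero] at hc
      rw [task, if_neg (layer_ne_of_mem_crossEdges hcross), hc, zero_mul]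
    simp [Queues.delay, hnode]
  · intro x hx
    obtain ⟨e, he, rfl⟩ := List.mem_map.1 hx
    split_ifs with hl
    · have h0 := hσ0 e he
      rw [serviceTime_of_mem_intraEdges ((mem_intraEdges_iff (σ.mem_layeredEdges he)).2 hl),
        ENNReal.div_eq_zero_iff] at h0
      have hd := jobs.d_pos (G.order p) e.1.1 (Nat.lt_succ_iff.1 e.1.1.2)
      have htop := h0.resolve_left (by simpa using hd.ne')
      simp [Queues.delay, htop]
    · rfl
  · intro x hx
    obtain ⟨e, he, rfl⟩ := List.mem_map.1 hx
    exact hσ0 e he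

end Comparison

/-! ### The approximation ratio -/

section Ratio

variable {N : Network V} {jobs : Jobs V} {k : ℕ}

lemma maxData_ne_top (jobs : Jobs V) : jobs.maxData ≠ ∞ := by
  refine ne_top_of_le_ne_top
    (b := ∑ j, ∑ l ∈ Finset.range (jobs.L j + 1), (jobs.d j l : ℝ≥0∞)) (by simp) ?_
  refine iSup_le fun j => iSup₂_le fun l hl => ?_
  refine le_trans ?_ (Finset.single_le_sum (fun _ _ => zero_le) (Finset.mem_univ j))
  exact Finset.single_le_sum (f := fun l => (jobs.d j l : ℝ≥0∞)) (fun _ _ => zero_le)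
    (Finset.mem_range.2 (Nat.lt_succ_iff.2 hl))

lemma minData_ne_zero (j : Fin jobs.J) : jobs.minData ≠ 0 := by
  obtain ⟨x, hx, hmin⟩ := Finset.exists_min_image
    (Finset.univ.sigma fun j => Finset.range (jobs.L j + 1)) (fun x => jobs.d x.1 x.2)
    ⟨⟨j, 0⟩, by simp⟩
  rw [Finset.mem_sigma, Finset.mem_range, Nat.lt_succ_iff] at hx
  refine ((ENNReal.coe_pos.2 (jobs.d_pos x.1 x.2 hx.2)).trans_le ?_).ne'
  refine le_iInf fun j => le_iInf₂ fun l hl => ENNReal.coe_le_coe.2 (hmin ⟨j, l⟩ ?_)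
  simpa [Nat.lt_succ_iff] using hl

lemma minData_ne_top (j : Fin jobs.J) : jobs.minData ≠ ∞ :=
  ne_top_of_le_ne_top ENNReal.coe_ne_top
    (iInf_le_of_le j (iInf₂_le (f := fun l (_ : l ≤ jobs.L j) => (jobs.d j l : ℝ≥0∞)) 0
      (Nat.zero_le _)))

lemma maxData_ne_zero (j : Fin jobs.J) : jobs.maxData ≠ 0 := by
  refine ((ENNReal.coe_pos.2 (jobs.d_pos j 0 (Nat.zero_le _))).trans_le ?_).ne'
  exact le_iSup_of_le j (le_iSup₂ (f := fun l (_ : l ≤ jobs.L j) => (jobs.d j l : ℝ≥0∞)) 0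
    (Nat.zero_le _))

lemma hShort_pos (hk : 1 ≤ k) (hconn : N.IsEdgeConnected k) (hne : ∀ j, jobs.src j ≠ jobs.dst j)
    (j₀ : Fin jobs.J) : 1 ≤ hShort N jobs := by
  have : Nonempty (Fin jobs.J) := ⟨j₀⟩
  refine le_ciInf fun j => ?_
  obtain ⟨p, hp, hnd, -⟩ := exists_path_mul_le hk hconn 0 (jobs.src j) (jobs.dst j)
  have hmem : (pairs p).length ∈ N.pathLengths (jobs.src j) (jobs.dst j) := by
    rw [pathLengths_eq]
    exact ⟨p, hp, hnd, hp.length_eq⟩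
  rw [Nat.one_le_iff_ne_zero]
  intro h0
  have h1 := Nat.sInf_mem ⟨_, hmem⟩
  rw [h0, pathLengths_eq] at h1
  obtain ⟨q, hq, -, hlen⟩ := h1
  obtain ⟨v, rfl⟩ := List.length_eq_one_iff.1 hlen
  have h2 := hq.head_eq
  have h3 := hq.last_eq
  simp only [List.head?_cons, List.getLast?_singleton, Option.some.injEq] at h2 h3
  exact hne j (h2.symm.trans h3)

lemma alphaTx_eq (N : Network V) (jobs : Jobs V) :
    alphaTx N jobs = ((hLong N jobs : ℝ≥0∞) * jobs.maxData * N.maxLink)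
      / ((hShort N jobs : ℝ≥0∞) * jobs.minData * N.minLink) := rfl

/-- If not all links have finite capacity, but some have, then `α_tx` is infinite. -/
lemma alphaTx_eq_top (hL : 1 ≤ hLong N jobs) (j : Fin jobs.J) {e f : V × V} (he : e ∈ N.E)
    (he' : N.linkRate e.1 e.2 = ∞) (hf : f ∈ N.E) (hf' : N.linkRate f.1 f.2 ≠ ∞) :
    alphaTx N jobs = ∞ := by
  have hmax : N.maxLink = ∞ := top_le_iff.1
    (he' ▸ le_iSup₂ (f := fun e (_ : e ∈ N.E) => N.linkRate e.1 e.2) e he)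
  have hmin : N.minLink ≠ ∞ := ne_top_of_le_ne_top hf'
    (iInf₂_le (f := fun e (_ : e ∈ N.E) => N.linkRate e.1 e.2) f hf)
  have hL0 : (hLong N jobs : ℝ≥0∞) ≠ 0 := by
    rw [Nat.cast_ne_zero]
    omega
  rw [alphaTx_eq, hmax, ENNReal.mul_top (mul_ne_zero hL0 (maxData_ne_zero j))]
  exact ENNReal.top_div_of_ne_top (ENNReal.mul_ne_top
    (ENNReal.mul_ne_top (ENNReal.natCast_ne_top _) (minData_ne_top j)) hmin)

/-- If all links have infinite capacity, then transmissions take no time and `α_tx = 0`. -/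
lemma alphaTx_of_forall_eq_top (hS : 1 ≤ hShort N jobs) (j : Fin jobs.J)
    (hE : ∀ e ∈ N.E, N.linkRate e.1 e.2 = ∞) : maxHop N jobs = 0 ∧ alphaTx N jobs = 0 := by
  have hmin : N.minLink = ∞ := by
    simp only [Network.minLink, iInf_eq_top]
    exact hE
  have hS0 : (hShort N jobs : ℝ≥0∞) ≠ 0 := by
    rw [Nat.cast_ne_zero]
    omega
  rw [maxHop, alphaTx_eq, hmin, ENNReal.mul_top (mul_ne_zero hS0 (minData_ne_zero j))]
  simp

lemma alphaTx_of_forall_ne_top (hS : 1 ≤ hShort N jobs) (j : Fin jobs.J) (hne : N.E.Nonempty)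
    (hE : ∀ e ∈ N.E, N.linkRate e.1 e.2 ≠ ∞) :
    alphaTx N jobs ≠ ∞ ∧ hLong N jobs * maxHop N jobs
      ≤ alphaTx N jobs * (hShort N jobs * minHop N jobs) := by
  obtain ⟨e₀, he₀⟩ := hne
  have hmax : N.maxLink ≠ ∞ := by
    rw [Network.maxLink, ← Finset.sup_eq_iSup N.E fun e => N.linkRate e.1 e.2]
    exact ((Finset.sup_lt_iff ENNReal.zero_lt_top).2 fun e he => lt_top_iff_ne_top.2 (hE e he)).ne
  have hmax0 : N.maxLink ≠ 0 := ((N.linkRate_pos _ _ he₀).trans_le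
    (le_iSup₂ (f := fun e (_ : e ∈ N.E) => N.linkRate e.1 e.2) e₀ he₀)).ne'
  have hmin0 : N.minLink ≠ 0 := by
    rw [Network.minLink, ← Finset.inf_eq_iInf N.E fun e => N.linkRate e.1 e.2]
    exact ((Finset.lt_inf_iff ENNReal.zero_lt_top).2 fun e he => N.linkRate_pos _ _ he).ne'
  have hmin : N.minLink ≠ ∞ := ne_top_of_le_ne_top (hE e₀ he₀)
    (iInf₂_le (f := fun e (_ : e ∈ N.E) => N.linkRate e.1 e.2) e₀ he₀)
  have hS0 : (hShort N jobs : ℝ≥0∞) ≠ 0 := by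
    rw [Nat.cast_ne_zero]
    omega
  have hd0 := minData_ne_zero j
  have hd := minData_ne_top j
  rw [alphaTx_eq, maxHop, minHop]
  refine ⟨ENNReal.div_ne_top (ENNReal.mul_ne_top (ENNReal.mul_ne_top (ENNReal.natCast_ne_top _)
    (maxData_ne_top jobs)) hmax) (mul_ne_zero (mul_ne_zero hS0 hd0) hmin0), le_of_eq ?_⟩
  rw [div_eq_mul_inv, div_eq_mul_inv, div_eq_mul_inv,
    ENNReal.mul_inv (Or.inr hmin) (Or.inr hmin0), ENNReal.mul_inv (Or.inr hd) (Or.inr hd0)]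
  calc (hLong N jobs : ℝ≥0∞) * (jobs.maxData * N.minLink⁻¹)
      = hLong N jobs * (jobs.maxData * N.minLink⁻¹) * ((hShort N jobs : ℝ≥0∞)⁻¹ * hShort N jobs)
          * (jobs.minData⁻¹ * jobs.minData) * (N.maxLink * N.maxLink⁻¹) := by
        rw [ENNReal.inv_mul_cancel hS0 (ENNReal.natCast_ne_top _), ENNReal.inv_mul_cancel hd0 hd,
          ENNReal.mul_inv_cancel hmax0 hmax, mul_one, mul_one, mul_one]
    _ = _ := by ring

/-- The time of the computations at the slowest node is `α_cp` times that at the fastest one. -/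
lemma div_minNode_eq (x : ℝ≥0∞) (N : Network V) :
    x / N.minNode = alphaCp N * (x / N.maxNode) := by
  have h : alphaCp N = N.maxNode / N.minNode := rfl
  rw [h, div_eq_mul_inv, div_eq_mul_inv, div_eq_mul_inv]
  calc x * N.minNode⁻¹ = x * N.minNode⁻¹ * (N.maxNode * N.maxNode⁻¹) := by
        rw [ENNReal.mul_inv_cancel (maxNode_ne_zero N) (maxNode_ne_top N), mul_one]
    _ = _ := by ring

end Ratio

/-! ### Assembling the ratio -/

section Final

variable {N : Network V} {jobs : Jobs V} {k : ℕ}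

/-- The ratio without the factor `2 - 1 / (|V_P| + |E_P|)`. -/
def baseRatio (N : Network V) (jobs : Jobs V) (k : ℕ) : ℝ≥0∞ :=
  max (2 * alphaTx N jobs)
    (max (2 * ((maxLayers jobs : ℝ≥0∞) + 1) * ((numNodes N : ℝ≥0∞) + numLinks N)
        * alphaTx N jobs / k)
      ((1 + (numLinks N : ℝ≥0∞) / numNodes N) * alphaCp N))

lemma alpha_eq (N : Network V) (jobs : Jobs V) (k : ℕ) :
    alpha N jobs k = baseRatio N jobs k * (2 - 1 / ((numNodes N : ℝ≥0∞) + numLinks N)) := rfl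

/-- The second term of the ratio, with its factor `L + 1` dropped. -/
lemma mul_div_le_baseRatio : 2 * ((numNodes N : ℝ≥0∞) + numLinks N) * alphaTx N jobs / k
    ≤ baseRatio N jobs k := by
  refine le_trans ?_ ((le_max_left _ _).trans (le_max_right _ _))
  gcongr
  exact le_mul_of_one_le_right zero_le le_add_self

lemma mul_alphaCp_le_baseRatio :
    (1 + (numLinks N : ℝ≥0∞) / numNodes N) * alphaCp N ≤ baseRatio N jobs k :=
  (le_max_right _ _).trans (le_max_right _ _)

lemma numNodes_ne_zero (N : Network V) : (numNodes N : ℝ≥0∞) ≠ 0 := by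
  simpa using (numNodes_pos N).ne'

lemma alphaCp_ne_top (N : Network V) : alphaCp N ≠ ∞ :=
  ENNReal.div_ne_top (maxNode_ne_top N) (minNode_ne_zero N)

lemma alphaCp_ne_zero (N : Network V) : alphaCp N ≠ 0 :=
  (ENNReal.div_pos (maxNode_ne_zero N) (minNode_ne_top N)).ne'

lemma baseRatio_ne_zero : baseRatio N jobs k ≠ 0 := by
  have h : alphaCp N ≤ baseRatio N jobs k :=
    (le_mul_of_one_le_left zero_le le_self_add).trans mul_alphaCp_le_baseRatio
  exact ((pos_iff_ne_zero.2 (alphaCp_ne_zero N)).trans_le h).ne'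

lemma baseRatio_ne_top (hk : 1 ≤ k) (h : alphaTx N jobs ≠ ∞) : baseRatio N jobs k ≠ ∞ := by
  have hk0 : (k : ℝ≥0∞) ≠ 0 := by
    rw [Nat.cast_ne_zero]
    omega
  have h1 : (numLinks N : ℝ≥0∞) / numNodes N ≠ ∞ :=
    ENNReal.div_ne_top (ENNReal.natCast_ne_top _) (numNodes_ne_zero N)
  simp only [baseRatio, ne_eq, max_eq_top, not_or]
  refine ⟨by finiteness, ENNReal.div_ne_top (by finiteness) hk0, ?_⟩
  exact ENNReal.mul_ne_top (by finiteness) (alphaCp_ne_top N)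

lemma two_sub_ne_zero (N : Network V) :
    (2 : ℝ≥0∞) - 1 / ((numNodes N : ℝ≥0∞) + numLinks N) ≠ 0 := by
  have h : 1 / ((numNodes N : ℝ≥0∞) + numLinks N) ≤ 1 := by
    rw [one_div, ENNReal.inv_le_one]
    exact le_trans (by exact_mod_cast numNodes_pos N) le_self_add
  exact (tsub_pos_of_lt (h.trans_lt ENNReal.one_lt_two)).ne'

/-- The comparison of the greedy run with any schedule, once the transmission times and `α_tx` are
related. Either all links have finite capacity, and there are at least `k |V|` of them, or
transmissions take no time. -/
lemma GreedyRun.completionTime_le_alpha_mul {G : GreedyRun N jobs} {ρ : ∀ j, Route N jobs j}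
    (hk : 1 ≤ k) (hconn : N.IsEdgeConnected k)
    (hρ : ∀ j, (ρ j).IsGivenBy (G.r j)) (hsimple : ∀ j, (ρ j).IsSimple)
    (hL : 1 ≤ hLong N jobs) (htop : alphaTx N jobs ≠ ∞)
    (htx : hLong N jobs * maxHop N jobs ≤ alphaTx N jobs * (hShort N jobs * minHop N jobs))
    (hcard : (k : ℝ≥0∞) * Fintype.card V * maxHop N jobs
      ≤ ((numNodes N : ℝ≥0∞) + numLinks N) * maxHop N jobs) :
    completionTime G.order ρ ≤ alpha N jobs k * optTime N jobs := by
  have hk0 : (k : ℝ≥0∞) ≠ 0 := by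
    rw [Nat.cast_ne_zero]
    omega
  have hktop : (k : ℝ≥0∞) ≠ ∞ := ENNReal.natCast_ne_top k
  have hV0 := numNodes_ne_zero N
  have hVtop : (numNodes N : ℝ≥0∞) ≠ ∞ := ENNReal.natCast_ne_top _
  have hm0 : (numNodes N : ℝ≥0∞) + numLinks N ≠ 0 := by simp [(numNodes_pos N).ne']
  have hmtop : (numNodes N : ℝ≥0∞) + numLinks N ≠ ∞ := by finiteness
  have hfac : 1 + (numLinks N : ℝ≥0∞) / numNodes N
      = ((numNodes N : ℝ≥0∞) + numLinks N) * (numNodes N : ℝ≥0∞)⁻¹ := by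
    rw [add_mul, ENNReal.mul_inv_cancel hV0 hVtop, div_eq_mul_inv]
  rw [alpha_eq, optTime, ENNReal.mul_iInf_of_ne (mul_ne_zero baseRatio_ne_zero (two_sub_ne_zero N))
    (ENNReal.mul_ne_top (baseRatio_ne_top hk htop) (by finiteness))]
  refine le_iInf fun S => completionTime_le hρ hsimple fun p =>
    optValue_le_mul_makespan hk hconn hρ hsimple p S ?_ ?_ ?_ ?_
  · intro j
    rw [div_minNode_eq]
    gcongr
    exact (le_mul_of_one_le_left zero_le le_self_add).trans mul_alphaCp_le_baseRatio
  · intro j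
    refine le_trans (le_of_eq ?_) (mul_le_mul_left mul_alphaCp_le_baseRatio _)
    rw [div_minNode_eq, hfac]
    generalize jobs.work j / N.maxNode = x
    generalize (numNodes N : ℝ≥0∞) + numLinks N = m at hm0 hmtop ⊢
    rw [div_eq_mul_inv, div_eq_mul_inv]
    calc alphaCp N * x * (numNodes N : ℝ≥0∞)⁻¹
        = alphaCp N * x * (numNodes N : ℝ≥0∞)⁻¹ * (m * m⁻¹) := by
          rw [ENNReal.mul_inv_cancel hm0 hmtop, mul_one]
      _ = _ := by ring
  · refine le_trans ?_ (mul_le_mul_left mul_div_le_baseRatio _)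
    have hL' : (1 : ℝ≥0∞) ≤ hLong N jobs := by exact_mod_cast hL
    calc 2 * (Fintype.card V : ℝ≥0∞) * maxHop N jobs
        = 2 * (k * Fintype.card V * maxHop N jobs) * (k : ℝ≥0∞)⁻¹ := by
          rw [← mul_one (2 * (Fintype.card V : ℝ≥0∞) * maxHop N jobs),
            ← ENNReal.mul_inv_cancel hk0 hktop]
          ring
      _ ≤ 2 * (((numNodes N : ℝ≥0∞) + numLinks N) * maxHop N jobs) * (k : ℝ≥0∞)⁻¹ := by gcongr
      _ ≤ 2 * (((numNodes N : ℝ≥0∞) + numLinks N) * (hLong N jobs * maxHop N jobs))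
            * (k : ℝ≥0∞)⁻¹ := by
          gcongr
          exact le_mul_of_one_le_left zero_le hL'
      _ ≤ 2 * (((numNodes N : ℝ≥0∞) + numLinks N)
            * (alphaTx N jobs * (hShort N jobs * minHop N jobs))) * (k : ℝ≥0∞)⁻¹ := by gcongr
      _ = _ := by
          rw [div_eq_mul_inv]
          ring
  · refine le_trans ?_ (mul_le_mul_left mul_div_le_baseRatio _)
    generalize (numNodes N : ℝ≥0∞) + numLinks N = m at hm0 hmtop ⊢
    calc 2 * (hLong N jobs * maxHop N jobs / k)
        ≤ 2 * (alphaTx N jobs * (hShort N jobs * minHop N jobs) / k) := by gcongr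
      _ = 2 * (alphaTx N jobs * (hShort N jobs * minHop N jobs) / k) * (m * m⁻¹) := by
          rw [ENNReal.mul_inv_cancel hm0 hmtop, mul_one]
      _ = _ := by
          simp only [div_eq_mul_inv]
          ring

end Final

end DNNRouting

end

theorem theorem2 {V : Type*} [Fintype V] [DecidableEq V]
    (N : DNNRouting.Network V) (jobs : DNNRouting.Jobs V)
    (hne : ∀ j, jobs.src j ≠ jobs.dst j)
    (k : ℕ) (hk : 1 ≤ k) (hconn : N.IsEdgeConnected k)
    (G : DNNRouting.GreedyRun N jobs)
    (ρ : ∀ j, DNNRouting.Route N jobs j)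
    (hρ : ∀ j, (ρ j).IsGivenBy (G.r j)) (hsimple : ∀ j, (ρ j).IsSimple) :
    DNNRouting.completionTime G.order ρ
      ≤ DNNRouting.alpha N jobs k * DNNRouting.optTime N jobs := by
  open DNNRouting in
  rcases isEmpty_or_nonempty (Fin jobs.J) with hJ | ⟨⟨j⟩⟩
  · exact (GreedyRun.completionTime_le hρ hsimple (X := 0) fun p => hJ.elim p).trans zero_le
  have : Nontrivial V := ⟨_, _, hne j⟩
  have hcard := mul_card_le_card_links hconn
  have hE : N.E.Nonempty := Finset.card_pos.1
    ((Nat.mul_pos hk Fintype.card_pos).trans_le hcard)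
  have hS := hShort_pos hk hconn hne j
  have hL : 1 ≤ hLong N jobs :=
    hS.trans ((ρ j).hShort_le_hops.trans (Route.hops_le_hLong (hsimple j)))
  by_cases hfin : ∀ e ∈ N.E, N.linkRate e.1 e.2 ≠ ⊤
  · obtain ⟨htop, htx⟩ := alphaTx_of_forall_ne_top hS j hE hfin
    refine GreedyRun.completionTime_le_alpha_mul hk hconn hρ hsimple hL htop htx ?_
    have hlinks : numLinks N = N.E.card := by
      rw [numLinks, Finset.filter_true_of_mem hfin]
    rw [hlinks]
    gcongr
    refine le_trans ?_ le_add_self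
    exact_mod_cast hcard
  by_cases hinf : ∀ e ∈ N.E, N.linkRate e.1 e.2 = ⊤
  · obtain ⟨hhop, htx⟩ := alphaTx_of_forall_eq_top hS j hinf
    exact GreedyRun.completionTime_le_alpha_mul hk hconn hρ hsimple hL (by simp [htx])
      (by simp [hhop]) (by simp [hhop])
  · push Not at hfin hinf
    obtain ⟨e, he, he'⟩ := hfin
    obtain ⟨f, hf, hf'⟩ := hinf
    -- Here `α = ∞`, and the bound is trivial unless `T^* = 0`, where `∞ * 0 = 0`.
    rcases eq_or_ne (optTime N jobs) 0 with h0 | h0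
    · exact (GreedyRun.completionTime_eq_zero hρ hsimple h0).le.trans zero_le
    · have htop := alphaTx_eq_top hL j he he' hf hf'
      have hbase : baseRatio N jobs k = ⊤ := by
        rw [baseRatio, htop, ENNReal.mul_top two_ne_zero]
        exact max_eq_left le_top
      rw [alpha_eq, hbase, ENNReal.top_mul (two_sub_ne_zero N), ENNReal.top_mul h0]
      exact le_top
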